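/- Let $G$ be a finite two-player concurrent stochastic game: finite state set $S$ with $n=|S|$, finite nonempty action sets $A$ (Player 1) and $B$ (Player 2), and a transition function $\delta$ assigning to each $(s,a,b)\in S\times A\times B$ a probability distribution $\delta(s,a,b)$ on $S$. Let $r:S\times A\times B\to\mathbb R$ be a reward function, $d\ge 1$, $\chi:S\to\{1,\dots,d\}$ an assignment function, and $s\in S$ a state. For $\lambda_1,\dots,\lambda_d\in(0,1)$ let $\Lambda(s')=\lambda_{\chi(s')}$. The $\Lambda$-discounted payoff of a play $(s_t,a_t,b_t)_{t\ge0}$ is $\sum_{t\ge 0}\big(\prod_{j<t}(1-\Lambda(s_j))\big)\Lambda(s_t)\,r(s_t,a_t,b_t)$, and $\mathrm{val}_\Lambda(s)$ is the supremum over (history-dependent, randomized) strategies of Player 1 of the infimum over strategies of Player 2 of the expected payoff from $s$. The limit value is $$\mathrm{val}_\chi(s)=\lim_{\lambda_1\to0^+}\cdots\lim_{\lambda_d\to0^+}\mathrm{val}_\Lambda(s).$$ For pure stationary strategies $\sigma:S\to A$, $\tau:S\to B$, let $P^{\sigma,\tau}(s',s'')=\delta(s',\sigma(s'),\tau(s'))(s'')$,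 let $M$ be the $S\times S$ matrix with entries $M_{s',s''}=\mathbf 1_{s'=s''}-(1-\Lambda(s'))P^{\sigma,\tau}(s',s'')$, let $\nabla_\Lambda(\sigma,\tau)=\det M$, and let $\nabla^s_\Lambda(\sigma,\tau)$ be the determinant of the matrix obtained from $M$ by replacing column $s$ by the vector $(\Lambda(s')\,r(s',\sigma(s'),\tau(s')))_{s'\in S}$. For $z\in\mathbb R$ let $W^s_\Lambda(z)$ be the matrix game with entries $\nabla^s_\Lambda(\sigma,\tau)-z\,\nabla_\Lambda(\sigma,\tau)$, with rows indexed by $\sigma$ and columns by $\tau$, let $\mathrm{val}(W^s_\Lambda(z))$ be its value in mixed strategies for the maximizing row player, and let $$F^s_\chi(z)=\lim_{\lambda_1\to0^+}\cdots\lim_{\lambda_d\to0^+}\frac{\mathrm{val}(W^s_\Lambda(z))}{(\lambda_d)^n}.$$ In both iterated limits the innermost limit, in $\lambda_d$, is taken first, and each inner limit is required to exist for all sufficiently small values of the outer variables. Then: 1. For every $z\in\mathbb R$ the iterated limit $F^s_\chi(z)$ exists in $\mathbb R\cup\{-\infty,+\infty\}$. 2. There exist $z_1,z_2\in\mathbb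 R$ with $F^s_\chi(z_2)\le 0\le F^s_\chi(z_1)$. 3. The iterated limit $\mathrm{val}_\chi(s)$ exists in $\mathbb R$, and it is the unique $z^*\in\mathbb R$ such that $F^s_\chi(z)<0$ for all $z>z^*$ and $F^s_\chi(z)>0$ for all $z<z^*$. -/

import Mathlib

open MeasureTheory ProbabilityTheory Filter Topology

noncomputable section

/-- A two-player concurrent stochastic game with states `S` and action sets `A` (Player 1) and
`B` (Player 2): the transition function gives the law of the next state. -/
structure CSG (S A B : Type*) where
  trans : S → A → B → PMF S

/-- One stage of a play: the current state and the two actions chosen simultaneously there. -/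
structure Stage (S A B : Type*) where
  state : S
  actOne : A
  actTwo : B

instance {S A B : Type*} : MeasurableSpace (Stage S A B) := ⊤

instance {S A B : Type*} : DiscreteMeasurableSpace (Stage S A B) := ⟨fun _ => trivial⟩

instance {S A B : Type*} [Finite S] [Finite A] [Finite B] : Finite (Stage S A B) :=
  Finite.of_injective (fun x : Stage S A B => (x.state, x.actOne, x.actTwo)) (by
    rintro ⟨s, a, b⟩ ⟨s', a', b'⟩ h
    simp only [Prod.mk.injEq] at h
    obtain ⟨rfl, rfl, rfl⟩ := h
    rfl)

/-- A (history-dependent, randomized) strategy of the player with action set `C`: from the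
`t` past stages and the current state it produces a mixed action. -/
def Strategy (S A B C : Type*) : Type _ :=
  (t : ℕ) → (Fin t → Stage S A B) → S → PMF C

/-- The supremum over mixed strategies of the row player of what this mixed strategy guarantees
against every mixed strategy of the column player. -/
def matrixVal {I J : Type*} [Fintype I] [Fintype J] (M : Matrix I J ℝ) : ℝ :=
  ⨆ x : stdSimplex ℝ I, ⨅ y : stdSimplex ℝ J, ∑ i, ∑ j, x.1 i * y.1 j * M i j

/-- `HasIterLim f L` says that the iterated limit
`lim_{x_0 → 0⁺} (lim_{x_1 → 0⁺} ( ⋯ lim_{x_{k-1} → 0⁺} f (x_0, …, x_{k-1})))` exists in the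
extended reals and equals `L`: the limit in the last variable is taken first, and every inner limit
has to exist for all small enough values of the outer variables. -/
def HasIterLim : {k : ℕ} → ((Fin k → ℝ) → EReal) → EReal → Prop
  | 0, f, L => f Fin.elim0 = L
  | _ + 1, f, L => ∃ g : ℝ → EReal,
      (∀ᶠ x in 𝓝[>] (0 : ℝ), HasIterLim (fun y => f (Fin.cons x y)) (g x)) ∧
        Tendsto g (𝓝[>] (0 : ℝ)) (𝓝 L)

/-- Iterated limits are unique. -/
theorem HasIterLim.unique {k : ℕ} {f : (Fin k → ℝ) → EReal} {L L' : EReal}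
    (h : HasIterLim f L) (h' : HasIterLim f L') : L = L' := by
  induction k generalizing L L' with
  | zero => exact Eq.trans (Eq.symm h) h'
  | succ k ih =>
    obtain ⟨g, hg, hL⟩ := h
    obtain ⟨g', hg', hL'⟩ := h'
    refine tendsto_nhds_unique_of_eventuallyEq hL hL' ?_
    filter_upwards [hg, hg'] with x hx hx'
    exact ih hx hx'

/-- The iterated limit (meaningful when it exists, i.e. when `∃ L, HasIterLim f L`). -/
def iterLim {k : ℕ} (f : (Fin k → ℝ) → EReal) : EReal :=
  Classical.epsilon (HasIterLim f)

theorem HasIterLim.iterLim_eq {k : ℕ} {f : (Fin k → ℝ) → EReal} {L : EReal}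
    (h : HasIterLim f L) : iterLim f = L :=
  (Classical.epsilon_spec ⟨L, h⟩ : HasIterLim f (iterLim f)).unique h

namespace CSG

variable {S A B : Type*}

/-- The law of a stage, given the law `p` of its state and the mixed actions as functions of the
state; the two players randomize independently. -/
def stageLaw (p : PMF S) (σ : S → PMF A) (τ : S → PMF B) : PMF (Stage S A B) :=
  p.bind fun s => (σ s).bind fun a => (τ s).bind fun b => PMF.pure ⟨s, a, b⟩

/-- The law of stage `n + 1` given the stages `0, …, n`. -/
def stepLaw (G : CSG S A B) (σ : Strategy S A B A) (τ : Strategy S A B B) (n : ℕ)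
    (p : (i : Finset.Iic n) → Stage S A B) : PMF (Stage S A B) :=
  let hist : Fin (n + 1) → Stage S A B :=
    fun i => p ⟨i, Finset.mem_Iic.2 (Nat.lt_succ_iff.1 i.2)⟩
  let last : Stage S A B := hist (Fin.last n)
  stageLaw (G.trans last.state last.actOne last.actTwo) (σ (n + 1) hist) (τ (n + 1) hist)

section Play

variable [Finite S] [Finite A] [Finite B]

def stepKernel (G : CSG S A B) (σ : Strategy S A B A) (τ : Strategy S A B B) (n : ℕ) :
    Kernel ((i : Finset.Iic n) → Stage S A B) (Stage S A B) :=
  Kernel.ofFunOfCountable fun p => (G.stepLaw σ τ n p).toMeasure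

instance (G : CSG S A B) (σ : Strategy S A B A) (τ : Strategy S A B B) (n : ℕ) :
    IsMarkovKernel (G.stepKernel σ τ n) :=
  ⟨fun p => by
    change IsProbabilityMeasure (G.stepLaw σ τ n p).toMeasure
    infer_instance⟩

/-- The probability measure on infinite plays induced by the initial state `s` and the strategies
`σ` and `τ`. -/
def playMeasure (G : CSG S A B) (σ : Strategy S A B A) (τ : Strategy S A B B) (s : S) :
    Measure (ℕ → Stage S A B) :=
  Kernel.trajMeasure (X := fun _ => Stage S A B)
    (stageLaw (PMF.pure s) (σ 0 Fin.elim0) (τ 0 Fin.elim0)).toMeasure (G.stepKernel σ τ)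

end Play

/-- The stateful-discounted payoff of a play, for the discount function `Lam`. -/
def discPayoff (r : S → A → B → ℝ) (Lam : S → ℝ) (ω : ℕ → Stage S A B) : ℝ :=
  ∑' t : ℕ, (∏ j ∈ Finset.range t, (1 - Lam (ω j).state)) *
    (Lam (ω t).state * r (ω t).state (ω t).actOne (ω t).actTwo)

/-- The stateful-discounted value `val_Λ(s)`. -/
def discVal [Finite S] [Finite A] [Finite B] (G : CSG S A B) (r : S → A → B → ℝ) (Lam : S → ℝ)
    (s : S) : ℝ :=
  ⨆ σ : Strategy S A B A, ⨅ τ : Strategy S A B B,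
    ∫ ω, discPayoff r Lam ω ∂(G.playMeasure σ τ s)

/-- The limit value `val_χ(s)`: the iterated limit of `val_Λ(s)`, where `Λ(s') = λ_{χ(s')}`. -/
def limitVal [Finite S] [Finite A] [Finite B] (G : CSG S A B) (r : S → A → B → ℝ) {d : ℕ}
    (χ : S → Fin (d + 1)) (s : S) : ℝ :=
  (iterLim fun lam : Fin (d + 1) → ℝ => ((G.discVal r (fun s' => lam (χ s')) s : ℝ) : EReal)).toReal

section Auxiliary

variable [Fintype A] [Fintype B]

/-- The transition matrix under stationary strategies. -/
def transMatrix (G : CSG S A B) (σ : S → PMF A) (τ : S → PMF B) : Matrix S S ℝ :=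
  Matrix.of fun s s' =>
    ∑ a, ∑ b, (σ s a).toReal * (τ s b).toReal * (G.trans s a b s').toReal

/-- The stage reward under stationary strategies. -/
def stageReward (r : S → A → B → ℝ) (σ : S → PMF A) (τ : S → PMF B) (s : S) : ℝ :=
  ∑ a, ∑ b, (σ s a).toReal * (τ s b).toReal * r s a b

/-- The matrix `Id - ((1 - Λ) 1ᵀ) ⊙ δ^{σ,τ}`. -/
def discMatrix [DecidableEq S] (G : CSG S A B) (Lam : S → ℝ) (σ : S → PMF A) (τ : S → PMF B) :
    Matrix S S ℝ :=
  1 - Matrix.of fun s s' => (1 - Lam s) * G.transMatrix σ τ s s'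

variable [Fintype S] [DecidableEq S]

/-- `∇_Λ(σ, τ)`. -/
def nabla (G : CSG S A B) (Lam : S → ℝ) (σ : S → PMF A) (τ : S → PMF B) : ℝ :=
  (G.discMatrix Lam σ τ).det

/-- `∇_Λ^s(σ, τ)`: the `s`-th column is replaced by `Λ ⊙ r^{σ,τ}`. -/
def nablaAt (G : CSG S A B) (r : S → A → B → ℝ) (Lam : S → ℝ) (s : S) (σ : S → PMF A)
    (τ : S → PMF B) : ℝ :=
  ((G.discMatrix Lam σ τ).updateCol s fun s' => Lam s' * stageReward r σ τ s').det

/-- The matrix game `W_Λ^s(z)`: rows and columns are the pure stationary strategies. -/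
def auxGame (G : CSG S A B) (r : S → A → B → ℝ) (Lam : S → ℝ) (s : S) (z : ℝ) :
    Matrix (S → A) (S → B) ℝ :=
  Matrix.of fun σ τ =>
    G.nablaAt r Lam s (fun s' => PMF.pure (σ s')) (fun s' => PMF.pure (τ s')) -
      z * G.nabla Lam (fun s' => PMF.pure (σ s')) (fun s' => PMF.pure (τ s'))

/-- The quotient `val(W_Λ^s(z)) / (λ_d)^n` as a function of the discount factors, where
`Λ(s') = λ_{χ(s')}` and `n` is the number of states. -/
def normalizedVal (G : CSG S A B) (r : S → A → B → ℝ) {d : ℕ} (χ : S → Fin (d + 1)) (s : S)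
    (z : ℝ) (lam : Fin (d + 1) → ℝ) : EReal :=
  ((matrixVal (G.auxGame r (fun s' => lam (χ s')) s z) /
    lam (Fin.last d) ^ Fintype.card S : ℝ) : EReal)

/-- The limit function `F_χ^s(z)`. -/
def limitFun (G : CSG S A B) (r : S → A → B → ℝ) {d : ℕ} (χ : S → Fin (d + 1)) (s : S)
    (z : ℝ) : EReal :=
  iterLim (G.normalizedVal r χ s z)

end Auxiliary

end CSG

end

section MatrixGame

variable {I J : Type*} [Fintype I] [Fintype J]

/-- Ville's theorem of the alternative. -/
theorem ville_alternative [Nonempty I] (M : Matrix I J ℝ) :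
    (∃ x ∈ stdSimplex ℝ I, ∀ j, 0 ≤ ∑ i, x i * M i j) ∨
      ∃ y ∈ stdSimplex ℝ J, ∀ i, ∑ j, M i j * y j < 0 := by
  classical
  by_cases hx : ∃ x ∈ stdSimplex ℝ I, ∀ j, 0 ≤ ∑ i, x i * M i j
  · exact Or.inl hx
  refine Or.inr ?_
  push Not at hx
  let L : (I → ℝ) →ₗ[ℝ] (J → ℝ) := M.vecMulLinear
  have hL : ∀ x j, L x j = ∑ i, x i * M i j := fun x j => rfl
  have hCc : Convex ℝ (L '' stdSimplex ℝ I) := (convex_stdSimplex ℝ I).linear_image L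
  have hCk : IsCompact (L '' stdSimplex ℝ I) :=
    (isCompact_stdSimplex ℝ I).image L.continuous_of_finiteDimensional
  have hDc : Convex ℝ (Set.Ici (0 : J → ℝ)) := convex_Ici 0
  have hDk : IsClosed (Set.Ici (0 : J → ℝ)) := isClosed_Ici
  have hdisj : Disjoint (L '' stdSimplex ℝ I) (Set.Ici (0 : J → ℝ)) := by
    rw [Set.disjoint_left]
    rintro _ ⟨x, hxΔ, rfl⟩ h0
    obtain ⟨j, hj⟩ := hx x hxΔ
    have h1 : (0 : ℝ) ≤ L x j := h0 j
    rw [hL] at h1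
    linarith
  obtain ⟨f, u, v, hfu, huv, hvf⟩ := geometric_hahn_banach_compact_closed hCc hCk hDc hDk hdisj
  have hf : ∀ w : J → ℝ, f w = ∑ j, w j * f (Pi.single j 1) := by
    intro w
    conv_lhs => rw [pi_eq_sum_univ' w]
    simp [map_sum, map_smul]
  have hv0 : v < 0 := by simpa using hvf 0 (Set.mem_Ici.2 le_rfl)
  have hpos : ∀ j, 0 ≤ f (Pi.single j 1) := by
    intro j
    by_contra! hneg
    have h1 := hvf ((v / f (Pi.single j 1)) • Pi.single j 1) (by
      refine Set.mem_Ici.2 (smul_nonneg (div_nonneg_of_nonpos hv0.le hneg.le) ?_)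
      exact Pi.single_nonneg.2 zero_le_one)
    rw [map_smul, smul_eq_mul, div_mul_cancel₀ _ hneg.ne] at h1
    exact lt_irrefl _ h1
  have hneg : ∀ i, ∑ j, M i j * f (Pi.single j 1) < 0 := by
    intro i
    have h1 := hfu (L (Pi.single i 1)) ⟨_, single_mem_stdSimplex ℝ i, rfl⟩
    rw [hf] at h1
    have h2 : ∀ j, L (Pi.single i 1) j = M i j := by
      intro j
      rw [hL]
      simp [Pi.single_apply]
    simp only [h2] at h1
    linarith
  have hsum : 0 < ∑ j, f (Pi.single j 1) := by
    refine lt_of_le_of_ne (Finset.sum_nonneg fun j _ => hpos j) fun h0 => ?_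
    have h1 := (Finset.sum_eq_zero_iff_of_nonneg fun j _ => hpos j).1 h0.symm
    have h2 := hneg (Classical.arbitrary I)
    rw [Finset.sum_eq_zero fun j hj => by rw [h1 j hj, mul_zero]] at h2
    exact lt_irrefl _ h2
  refine ⟨fun j => f (Pi.single j 1) / ∑ j, f (Pi.single j 1),
    ⟨fun j => div_nonneg (hpos j) hsum.le, ?_⟩, fun i => ?_⟩
  · rw [← Finset.sum_div, div_self hsum.ne']
  · simp only [← mul_div_assoc]
    rw [← Finset.sum_div]
    exact div_neg_of_neg_of_pos (hneg i) hsum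

theorem stdSimplex_le_sum {x : I → ℝ} (hx : x ∈ stdSimplex ℝ I) {f : I → ℝ} {c : ℝ}
    (h : ∀ i, c ≤ f i) : c ≤ ∑ i, x i * f i := by
  calc c = ∑ i, x i * c := by rw [← Finset.sum_mul, hx.2, one_mul]
    _ ≤ _ := Finset.sum_le_sum fun i _ => mul_le_mul_of_nonneg_left (h i) (hx.1 i)

theorem stdSimplex_sum_le {x : I → ℝ} (hx : x ∈ stdSimplex ℝ I) {f : I → ℝ} {c : ℝ}
    (h : ∀ i, f i ≤ c) : ∑ i, x i * f i ≤ c := by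
  calc _ ≤ ∑ i, x i * c :=
        Finset.sum_le_sum fun i _ => mul_le_mul_of_nonneg_left (h i) (hx.1 i)
    _ = c := by rw [← Finset.sum_mul, hx.2, one_mul]

theorem bilinear_eq_left (M : Matrix I J ℝ) (x : I → ℝ) (y : J → ℝ) :
    ∑ i, ∑ j, x i * y j * M i j = ∑ i, x i * ∑ j, M i j * y j := by
  refine Finset.sum_congr rfl fun i _ => ?_
  rw [Finset.mul_sum]
  exact Finset.sum_congr rfl fun j _ => by ring

theorem bilinear_eq_right (M : Matrix I J ℝ) (x : I → ℝ) (y : J → ℝ) :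
    ∑ i, ∑ j, x i * y j * M i j = ∑ j, y j * ∑ i, x i * M i j := by
  rw [Finset.sum_comm]
  refine Finset.sum_congr rfl fun j _ => ?_
  rw [Finset.mul_sum]
  exact Finset.sum_congr rfl fun i _ => by ring

theorem exists_matrix_bound (M : Matrix I J ℝ) : ∃ C : ℝ, ∀ i j, |M i j| ≤ C := by
  obtain ⟨C, hC⟩ := (Set.finite_range fun p : I × J => |M p.1 p.2|).bddAbove
  exact ⟨C, fun i j => hC ⟨(i, j), rfl⟩⟩

theorem bddBelow_bilinear (M : Matrix I J ℝ) {x : I → ℝ} (hx : x ∈ stdSimplex ℝ I) :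
    BddBelow (Set.range fun y : stdSimplex ℝ J => ∑ i, ∑ j, x i * y.1 j * M i j) := by
  obtain ⟨C, hC⟩ := exists_matrix_bound M
  refine ⟨-C, ?_⟩
  rintro _ ⟨y, rfl⟩
  dsimp only
  rw [bilinear_eq_right]
  exact stdSimplex_le_sum y.2 fun j =>
    stdSimplex_le_sum hx fun i => (abs_le.1 (hC i j)).1

theorem bddAbove_guarantee [Nonempty J] (M : Matrix I J ℝ) :
    BddAbove (Set.range fun x : stdSimplex ℝ I =>
      ⨅ y : stdSimplex ℝ J, ∑ i, ∑ j, x.1 i * y.1 j * M i j) := by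
  classical
  obtain ⟨C, hC⟩ := exists_matrix_bound M
  refine ⟨C, ?_⟩
  rintro _ ⟨x, rfl⟩
  refine (ciInf_le (bddBelow_bilinear M x.2)
    ⟨_, single_mem_stdSimplex ℝ (Classical.arbitrary J)⟩).trans ?_
  rw [bilinear_eq_right]
  exact stdSimplex_sum_le (single_mem_stdSimplex ℝ _) fun j =>
    stdSimplex_sum_le x.2 fun i => (abs_le.1 (hC i j)).2

theorem le_matrixVal [Nonempty J] {M : Matrix I J ℝ} {c : ℝ} {x : I → ℝ}
    (hx : x ∈ stdSimplex ℝ I) (h : ∀ j, c ≤ ∑ i, x i * M i j) : c ≤ matrixVal M := by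
  classical
  have : Nonempty (stdSimplex ℝ J) := ⟨⟨_, single_mem_stdSimplex ℝ (Classical.arbitrary J)⟩⟩
  refine le_ciSup_of_le (bddAbove_guarantee M) ⟨x, hx⟩ (le_ciInf fun y => ?_)
  rw [bilinear_eq_right]
  exact stdSimplex_le_sum y.2 h

theorem matrixVal_le [Nonempty I] {M : Matrix I J ℝ} {c : ℝ} {y : J → ℝ}
    (hy : y ∈ stdSimplex ℝ J) (h : ∀ i, ∑ j, M i j * y j ≤ c) : matrixVal M ≤ c := by
  classical
  have : Nonempty (stdSimplex ℝ I) := ⟨⟨_, single_mem_stdSimplex ℝ (Classical.arbitrary I)⟩⟩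
  refine ciSup_le fun x => (ciInf_le (bddBelow_bilinear M x.2) ⟨y, hy⟩).trans ?_
  rw [bilinear_eq_left]
  exact stdSimplex_sum_le x.2 h

theorem exists_optimal_row [Nonempty I] (M : Matrix I J ℝ) :
    ∃ x ∈ stdSimplex ℝ I, ∀ j, matrixVal M ≤ ∑ i, x i * M i j := by
  rcases ville_alternative (Matrix.of fun i j => M i j - matrixVal M) with
    ⟨x, hx, h⟩ | ⟨y, hy, h⟩
  · refine ⟨x, hx, fun j => ?_⟩
    have h1 := h j
    simp only [Matrix.of_apply, mul_sub, Finset.sum_sub_distrib, ← Finset.sum_mul, hx.2] at h1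
    linarith
  · exfalso
    simp only [Matrix.of_apply, sub_mul, Finset.sum_sub_distrib, ← Finset.mul_sum, hy.2] at h
    obtain ⟨i, hi⟩ := Finite.exists_max fun i => ∑ j, M i j * y j
    have h1 := matrixVal_le hy hi
    linarith [h i]

theorem exists_optimal_col [Nonempty J] (M : Matrix I J ℝ) :
    ∃ y ∈ stdSimplex ℝ J, ∀ i, ∑ j, M i j * y j ≤ matrixVal M := by
  rcases ville_alternative (Matrix.of fun j i => matrixVal M - M i j) with
    ⟨y, hy, h⟩ | ⟨x, hx, h⟩
  · refine ⟨y, hy, fun i => ?_⟩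
    have h1 := h i
    simp only [Matrix.of_apply, mul_sub, Finset.sum_sub_distrib, ← Finset.sum_mul, hy.2,
      mul_comm (y _) (M _ _)] at h1
    linarith
  · exfalso
    simp only [Matrix.of_apply, sub_mul, Finset.sum_sub_distrib, ← Finset.mul_sum, hx.2,
      mul_comm (M _ _)] at h
    obtain ⟨j, hj⟩ := Finite.exists_min fun j => ∑ i, x i * M i j
    have h1 := le_matrixVal hx hj
    linarith [h j]

theorem le_matrixVal_iff [Nonempty I] [Nonempty J] {M : Matrix I J ℝ} {c : ℝ} :
    c ≤ matrixVal M ↔ ∃ x ∈ stdSimplex ℝ I, ∀ j, c ≤ ∑ i, x i * M i j := by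
  refine ⟨fun h => ?_, fun ⟨x, hx, h⟩ => le_matrixVal hx h⟩
  obtain ⟨x, hx, h'⟩ := exists_optimal_row M
  exact ⟨x, hx, fun j => h.trans (h' j)⟩

theorem matrixVal_le_add [Nonempty I] [Nonempty J] {M N : Matrix I J ℝ} {ε : ℝ}
    (h : ∀ i j, M i j ≤ N i j + ε) : matrixVal M ≤ matrixVal N + ε := by
  obtain ⟨y, hy, hN⟩ := exists_optimal_col N
  refine matrixVal_le hy fun i => ?_
  calc ∑ j, M i j * y j ≤ ∑ j, (N i j + ε) * y j :=
        Finset.sum_le_sum fun j _ => mul_le_mul_of_nonneg_right (h i j) (hy.1 j)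
    _ = ∑ j, N i j * y j + ε := by
        simp only [add_mul, Finset.sum_add_distrib, ← Finset.mul_sum, hy.2, mul_one]
    _ ≤ _ := by linarith [hN i]

end MatrixGame

section Determinants

variable {S : Type*} [Fintype S] [DecidableEq S]

theorem det_nonneg_of_sum_row_le_diag {A : Matrix S S ℝ}
    (h : ∀ k, ∑ j ∈ Finset.univ.erase k, |A k j| ≤ A k k) : 0 ≤ A.det := by
  let f : ℝ → ℝ := fun t => ((1 - t) • A + t • (1 : Matrix S S ℝ)).det
  have hf : Continuous f := by
    refine Continuous.matrix_det ?_
    fun_prop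
  have hne : ∀ t ∈ Set.Ioc (0 : ℝ) 1, f t ≠ 0 := by
    intro t ht
    refine det_ne_zero_of_sum_row_lt_diag fun k => ?_
    have h1 : ∀ j ∈ Finset.univ.erase k,
        ‖((1 - t) • A + t • (1 : Matrix S S ℝ)) k j‖ = (1 - t) * |A k j| := by
      intro j hj
      have hkj : k ≠ j := (Finset.ne_of_mem_erase hj).symm
      simp [Matrix.one_apply_ne hkj, abs_of_nonneg (sub_nonneg.2 ht.2)]
    rw [Finset.sum_congr rfl h1, ← Finset.mul_sum]
    have h2 : 0 ≤ A k k := (Finset.sum_nonneg fun j _ => abs_nonneg _).trans (h k)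
    have h3 := mul_le_mul_of_nonneg_left (h k) (sub_nonneg.2 ht.2)
    have h4 := mul_nonneg (sub_nonneg.2 ht.2) h2
    have h5 : ((1 - t) • A + t • (1 : Matrix S S ℝ)) k k = (1 - t) * A k k + t := by simp
    rw [h5, Real.norm_eq_abs, abs_of_nonneg (by linarith [ht.1])]
    linarith [ht.1]
  have h1 : f 1 = 1 := by simp [f]
  have hpos : ∀ t ∈ Set.Ioc (0 : ℝ) 1, 0 < f t := by
    intro t ht
    by_contra! hle
    obtain ⟨u, hu, hu0⟩ := intermediate_value_Icc ht.2 hf.continuousOn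
      (show (0 : ℝ) ∈ Set.Icc (f t) (f 1) from ⟨hle, by rw [h1]; exact zero_le_one⟩)
    exact hne u ⟨ht.1.trans_le hu.1, hu.2⟩ hu0
  have h0 : f 0 = A.det := by simp [f]
  rw [← h0]
  refine ge_of_tendsto (hf.continuousWithinAt (s := Set.Ioi 0) (x := 0)) ?_
  filter_upwards [Ioc_mem_nhdsGT (zero_lt_one (α := ℝ))] with t ht using (hpos t ht).le

/-- The matrix `Id - diag (1 - Λ) P`. -/
def discountedMatrix (Lam : S → ℝ) (P : Matrix S S ℝ) : Matrix S S ℝ :=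
  1 - Matrix.of fun s s' => (1 - Lam s) * P s s'

variable {Lam : S → ℝ} {P : Matrix S S ℝ}

theorem discountedMatrix_mulVec (u : S → ℝ) (s : S) :
    (discountedMatrix Lam P).mulVec u s = u s - (1 - Lam s) * ∑ s', P s s' * u s' := by
  rw [discountedMatrix, Matrix.sub_mulVec, Pi.sub_apply, Matrix.one_mulVec, Finset.mul_sum]
  simp [Matrix.mulVec, dotProduct, mul_assoc]

theorem prod_le_det_discountedMatrix (h0 : ∀ s, 0 ≤ Lam s) (h1 : ∀ s, Lam s ≤ 1)
    (hP : ∀ s s', 0 ≤ P s s') (hP1 : ∀ s, ∑ s', P s s' = 1) :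
    ∏ s, Lam s ≤ (discountedMatrix Lam P).det := by
  let m : S → S → ℝ := fun s s' => Matrix.diagonal Lam s s'
  let m' : S → S → ℝ := fun s s' => (1 - Lam s) * ((1 : Matrix S S ℝ) s s' - P s s')
  have hsum : discountedMatrix Lam P = Matrix.of (m + m') := by
    ext s s'
    by_cases h : s = s'
    · subst h
      simp [discountedMatrix, m, m']
      ring
    · simp [discountedMatrix, m, m', h]
  have hterm : ∀ T : Finset S, 0 ≤ (Matrix.of (T.piecewise m m')).det := by
    intro T
    refine det_nonneg_of_sum_row_le_diag fun k => ?_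
    by_cases hk : k ∈ T
    · simp only [Matrix.of_apply, Finset.piecewise_eq_of_mem _ _ _ hk]
      rw [Finset.sum_eq_zero]
      · simpa [m] using h0 k
      · intro j hj
        simp [m, (Finset.ne_of_mem_erase hj).symm]
    · simp only [Matrix.of_apply, Finset.piecewise_eq_of_notMem _ _ _ hk]
      have h2 : ∀ j ∈ Finset.univ.erase k, |m' k j| = (1 - Lam k) * P k j := by
        intro j hj
        simp [m', Matrix.one_apply_ne (Finset.ne_of_mem_erase hj).symm, abs_mul,
          abs_of_nonneg (sub_nonneg.2 (h1 k)), abs_of_nonneg (hP k j)]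
      rw [Finset.sum_congr rfl h2, ← Finset.mul_sum]
      have h3 := Finset.add_sum_erase Finset.univ (P k) (Finset.mem_univ k)
      rw [hP1] at h3
      have h4 : m' k k = (1 - Lam k) * (1 - P k k) := by simp [m']
      rw [h4, ← h3, add_sub_cancel_left]
  have hexp : (discountedMatrix Lam P).det =
      ∑ T : Finset S, (Matrix.of (T.piecewise m m')).det := by
    rw [hsum]
    exact (Matrix.detRowAlternating (n := S) (R := ℝ)).map_add_univ m m'
  rw [hexp]
  have h5 : ∏ s, Lam s =
      (Matrix.of ((Finset.univ : Finset S).piecewise m m')).det := by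
    rw [Finset.piecewise_univ]
    exact Matrix.det_diagonal.symm
  rw [h5]
  exact Finset.single_le_sum (fun T _ => hterm T) (Finset.mem_univ _)

theorem nonneg_of_discountedMatrix_mulVec_nonneg (h0 : ∀ s, 0 < Lam s) (h1 : ∀ s, Lam s ≤ 1)
    (hP : ∀ s s', 0 ≤ P s s') (hP1 : ∀ s, ∑ s', P s s' = 1) {u : S → ℝ}
    (hu : ∀ s, 0 ≤ (discountedMatrix Lam P).mulVec u s) (s : S) : 0 ≤ u s := by
  have : Nonempty S := ⟨s⟩
  obtain ⟨m, hm⟩ := Finite.exists_min u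
  refine le_trans ?_ (hm s)
  have h2 := hu m
  rw [discountedMatrix_mulVec] at h2
  have h3 : u m ≤ ∑ s', P m s' * u s' := stdSimplex_le_sum ⟨hP m, hP1 m⟩ hm
  have h4 := mul_le_mul_of_nonneg_left h3 (sub_nonneg.2 (h1 m))
  have h5 : 0 ≤ Lam m * u m := by linarith
  exact nonneg_of_mul_nonneg_right h5 (h0 m)

theorem mul_le_det_updateCol (h0 : ∀ s, 0 < Lam s) (h1 : ∀ s, Lam s ≤ 1)
    (hP : ∀ s s', 0 ≤ P s s') (hP1 : ∀ s, ∑ s', P s s' = 1) {g v : S → ℝ}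
    (hv : ∀ s, v s ≤ g s + (1 - Lam s) * ∑ s', P s s' * v s') (s : S) :
    (discountedMatrix Lam P).det * v s ≤ ((discountedMatrix Lam P).updateCol s g).det := by
  have hdet : 0 < (discountedMatrix Lam P).det :=
    (Finset.prod_pos fun s _ => h0 s).trans_le
      (prod_le_det_discountedMatrix (fun s => (h0 s).le) h1 hP hP1)
  have hunit : IsUnit (discountedMatrix Lam P).det := hdet.ne'.isUnit
  have hc := congrFun (Matrix.det_smul_inv_mulVec_eq_cramer (discountedMatrix Lam P) g hunit) s
  rw [Matrix.cramer_apply] at hc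
  rw [← hc, Pi.smul_apply, smul_eq_mul]
  refine mul_le_mul_of_nonneg_left ?_ hdet.le
  have hMu : (discountedMatrix Lam P).mulVec ((discountedMatrix Lam P)⁻¹.mulVec g) = g := by
    rw [Matrix.mulVec_mulVec, Matrix.mul_nonsing_inv _ hunit, Matrix.one_mulVec]
  have h2 := nonneg_of_discountedMatrix_mulVec_nonneg h0 h1 hP hP1
    (u := (discountedMatrix Lam P)⁻¹.mulVec g - v) (fun s => by
      rw [Matrix.mulVec_sub, hMu, Pi.sub_apply, discountedMatrix_mulVec]
      linarith [hv s]) s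
  rw [Pi.sub_apply] at h2
  linarith

theorem det_updateCol_le_mul (h0 : ∀ s, 0 < Lam s) (h1 : ∀ s, Lam s ≤ 1)
    (hP : ∀ s s', 0 ≤ P s s') (hP1 : ∀ s, ∑ s', P s s' = 1) {g v : S → ℝ}
    (hv : ∀ s, g s + (1 - Lam s) * ∑ s', P s s' * v s' ≤ v s) (s : S) :
    ((discountedMatrix Lam P).updateCol s g).det ≤ (discountedMatrix Lam P).det * v s := by
  have h := mul_le_det_updateCol h0 h1 hP hP1 (g := -g) (v := -v) (fun s => by
    simp only [Pi.neg_apply, mul_neg, Finset.sum_neg_distrib]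
    linarith [hv s]) s
  have h2 : ((discountedMatrix Lam P).updateCol s (-g)).det =
      -((discountedMatrix Lam P).updateCol s g).det := by
    have := Matrix.det_updateCol_smul (discountedMatrix Lam P) s (-1) g
    simpa using this
  rw [h2, Pi.neg_apply] at h
  linarith

/-- Averaging determinants over independent random rows. -/
theorem sum_prod_mul_det {C : Type*} [Fintype C] (x : S → C → ℝ) (R : S → C → S → ℝ) :
    ∑ σ : S → C, (∏ s, x s (σ s)) * Matrix.det (Matrix.of fun s => R s (σ s)) =
      Matrix.det (Matrix.of fun s s' => ∑ c, x s c * R s c s') := by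
  have h := (Matrix.detRowAlternating (n := S) (R := ℝ)).toMultilinearMap.map_sum
    (fun s c => x s c • R s c)
  have h2 : (fun s => ∑ c, x s c • R s c) = fun s s' => ∑ c, x s c * R s c s' := by
    ext s s'
    simp
  rw [h2] at h
  refine Eq.trans ?_ h.symm
  refine Finset.sum_congr rfl fun σ _ => ?_
  exact ((Matrix.detRowAlternating (n := S) (R := ℝ)).toMultilinearMap.map_smul_univ
    (fun s => x s (σ s)) (fun s => R s (σ s))).symm

theorem prod_mem_stdSimplex {C : Type*} [Fintype C] {x : S → C → ℝ}
    (hx : ∀ s, x s ∈ stdSimplex ℝ C) :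
    (fun σ : S → C => ∏ s, x s (σ s)) ∈ stdSimplex ℝ (S → C) := by
  refine ⟨fun σ => Finset.prod_nonneg fun s _ => (hx s).1 _, ?_⟩
  rw [← Fintype.prod_sum]
  exact Finset.prod_eq_one fun s _ => (hx s).2

section Mixture

variable {C : Type*} [Fintype C] {x : S → C → ℝ} (Q : S → C → S → ℝ)

theorem sum_prod_mul_det_discountedMatrix (hx : ∀ s, x s ∈ stdSimplex ℝ C) :
    ∑ σ : S → C, (∏ s, x s (σ s)) *
        (discountedMatrix Lam (Matrix.of fun s => Q s (σ s))).det =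
      (discountedMatrix Lam (Matrix.of fun s s' => ∑ c, x s c * Q s c s')).det := by
  have h := sum_prod_mul_det x fun s c s' => (1 : Matrix S S ℝ) s s' - (1 - Lam s) * Q s c s'
  refine Eq.trans h ?_
  congr 1
  ext s s'
  simp only [Matrix.of_apply, discountedMatrix, Matrix.sub_apply, mul_sub,
    Finset.sum_sub_distrib, ← Finset.sum_mul, (hx s).2, one_mul, Finset.mul_sum]
  congr 1
  exact Finset.sum_congr rfl fun c _ => by ring

theorem sum_prod_mul_det_updateCol (hx : ∀ s, x s ∈ stdSimplex ℝ C) (g : S → C → ℝ) (s₀ : S) :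
    ∑ σ : S → C, (∏ s, x s (σ s)) *
        ((discountedMatrix Lam (Matrix.of fun s => Q s (σ s))).updateCol s₀
          fun s => g s (σ s)).det =
      ((discountedMatrix Lam (Matrix.of fun s s' => ∑ c, x s c * Q s c s')).updateCol s₀
        fun s => ∑ c, x s c * g s c).det := by
  have h := sum_prod_mul_det x fun s c s' =>
    if s' = s₀ then g s c else (1 : Matrix S S ℝ) s s' - (1 - Lam s) * Q s c s'
  have h1 : ∀ σ : S → C, (discountedMatrix Lam (Matrix.of fun s => Q s (σ s))).updateCol s₀
      (fun s => g s (σ s)) = Matrix.of fun s s' =>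
        if s' = s₀ then g s (σ s) else (1 : Matrix S S ℝ) s s' - (1 - Lam s) * Q s (σ s) s' := by
    intro σ
    ext s s'
    simp [Matrix.updateCol_apply, discountedMatrix]
  simp only [h1]
  refine Eq.trans h ?_
  congr 1
  ext s s'
  rw [Matrix.updateCol_apply]
  by_cases hs : s' = s₀
  · simp [hs]
  · simp only [Matrix.of_apply, discountedMatrix, Matrix.sub_apply, mul_sub, hs, if_false,
      Finset.sum_sub_distrib, ← Finset.sum_mul, (hx s).2, one_mul, Finset.mul_sum]
    congr 1
    exact Finset.sum_congr rfl fun c _ => by ring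

variable {Q}

omit [Fintype S] [DecidableEq S] in
theorem mixture_nonneg (hx : ∀ s, x s ∈ stdSimplex ℝ C) (hQ : ∀ s c s', 0 ≤ Q s c s') (s s' : S) :
    0 ≤ (Matrix.of fun s s' => ∑ c, x s c * Q s c s') s s' :=
  Finset.sum_nonneg fun c _ => mul_nonneg ((hx s).1 c) (hQ s c s')

omit [DecidableEq S] in
theorem mixture_sum_eq_one (hx : ∀ s, x s ∈ stdSimplex ℝ C) (hQ1 : ∀ s c, ∑ s', Q s c s' = 1)
    (s : S) : ∑ s', (Matrix.of fun s s' => ∑ c, x s c * Q s c s') s s' = 1 := by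
  simp only [Matrix.of_apply]
  rw [Finset.sum_comm]
  simp only [← Finset.mul_sum, hQ1, mul_one, (hx s).2]

omit [DecidableEq S] in
theorem mixture_continuation (g : S → C → ℝ) (v : S → ℝ) (s : S) :
    ∑ c, x s c * (g s c + (1 - Lam s) * ∑ s', Q s c s' * v s') =
      ∑ c, x s c * g s c + (1 - Lam s) *
        ∑ s', (Matrix.of fun s s' => ∑ c, x s c * Q s c s') s s' * v s' := by
  simp only [mul_add, Finset.sum_add_distrib, Matrix.of_apply, Finset.sum_mul, Finset.mul_sum]
  congr 1
  rw [Finset.sum_comm]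
  exact Finset.sum_congr rfl fun c _ => Finset.sum_congr rfl fun s' _ => by ring

theorem prod_mul_le_mixture (h0 : ∀ s, 0 < Lam s) (h1 : ∀ s, Lam s ≤ 1)
    (hx : ∀ s, x s ∈ stdSimplex ℝ C) (hQ : ∀ s c s', 0 ≤ Q s c s')
    (hQ1 : ∀ s c, ∑ s', Q s c s' = 1) {g : S → C → ℝ} {v : S → ℝ}
    (hv : ∀ s, v s ≤ ∑ c, x s c * (g s c + (1 - Lam s) * ∑ s', Q s c s' * v s')) {s₀ : S} {z : ℝ}
    (hz : z ≤ v s₀) :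
    (∏ s, Lam s) * (v s₀ - z) ≤ ∑ σ : S → C, (∏ s, x s (σ s)) *
      (((discountedMatrix Lam (Matrix.of fun s => Q s (σ s))).updateCol s₀
          fun s => g s (σ s)).det -
        z * (discountedMatrix Lam (Matrix.of fun s => Q s (σ s))).det) := by
  simp only [mul_sub, Finset.sum_sub_distrib, mul_left_comm _ z, ← Finset.mul_sum]
  rw [sum_prod_mul_det_discountedMatrix Q hx, sum_prod_mul_det_updateCol Q hx]
  simp only [mixture_continuation] at hv
  have h2 := mul_le_det_updateCol h0 h1 (mixture_nonneg hx hQ) (mixture_sum_eq_one hx hQ1) hv s₀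
  have h3 := mul_le_mul_of_nonneg_right (prod_le_det_discountedMatrix (fun s => (h0 s).le) h1
    (mixture_nonneg hx hQ) (mixture_sum_eq_one hx hQ1)) (sub_nonneg.2 hz)
  linarith

theorem mixture_le_prod_mul (h0 : ∀ s, 0 < Lam s) (h1 : ∀ s, Lam s ≤ 1)
    (hx : ∀ s, x s ∈ stdSimplex ℝ C) (hQ : ∀ s c s', 0 ≤ Q s c s')
    (hQ1 : ∀ s c, ∑ s', Q s c s' = 1) {g : S → C → ℝ} {v : S → ℝ}
    (hv : ∀ s, ∑ c, x s c * (g s c + (1 - Lam s) * ∑ s', Q s c s' * v s') ≤ v s) {s₀ : S} {z : ℝ}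
    (hz : v s₀ ≤ z) :
    ∑ σ : S → C, (∏ s, x s (σ s)) *
      (((discountedMatrix Lam (Matrix.of fun s => Q s (σ s))).updateCol s₀
          fun s => g s (σ s)).det -
        z * (discountedMatrix Lam (Matrix.of fun s => Q s (σ s))).det) ≤
      (∏ s, Lam s) * (v s₀ - z) := by
  simp only [mul_sub, Finset.sum_sub_distrib, mul_left_comm _ z, ← Finset.mul_sum]
  rw [sum_prod_mul_det_discountedMatrix Q hx, sum_prod_mul_det_updateCol Q hx]
  simp only [mixture_continuation] at hv
  have h2 := det_updateCol_le_mul h0 h1 (mixture_nonneg hx hQ) (mixture_sum_eq_one hx hQ1) hv s₀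
  have h3 := mul_le_mul_of_nonneg_right (prod_le_det_discountedMatrix (fun s => (h0 s).le) h1
    (mixture_nonneg hx hQ) (mixture_sum_eq_one hx hQ1)) (sub_nonneg.2 hz)
  linarith

end Mixture

end Determinants

section FinitePMF

variable {α β : Type*} [Fintype α] [Fintype β]

theorem PMF.toReal_mem_stdSimplex (p : PMF α) : (fun a => (p a).toReal) ∈ stdSimplex ℝ α := by
  refine ⟨fun a => ENNReal.toReal_nonneg, ?_⟩
  have h : ∑ a, p a = 1 := by simpa only [tsum_fintype] using p.tsum_coe
  rw [← ENNReal.toReal_sum fun a _ => p.apply_ne_top a, h, ENNReal.toReal_one]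

theorem PMF.sum_bind (p : PMF α) (k : α → PMF β) (f : β → ℝ) :
    ∑ b, ((p.bind k) b).toReal * f b = ∑ a, (p a).toReal * ∑ b, (k a b).toReal * f b := by
  simp only [PMF.bind_apply, tsum_fintype, Finset.mul_sum]
  rw [Finset.sum_comm]
  refine Finset.sum_congr rfl fun b _ => ?_
  rw [ENNReal.toReal_sum fun a _ => ENNReal.mul_ne_top (p.apply_ne_top a) ((k a).apply_ne_top b),
    Finset.sum_mul]
  exact Finset.sum_congr rfl fun a _ => by rw [ENNReal.toReal_mul, mul_assoc]

theorem PMF.sum_pure (a : α) (f : α → ℝ) : ∑ b, ((PMF.pure a) b).toReal * f b = f a := by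
  classical
  rw [Finset.sum_eq_single a]
  · simp
  · intro b _ hb
    simp [PMF.pure_apply_of_ne _ _ hb]
  · simp

/-- The probability mass function with given real weights. -/
noncomputable def PMF.ofStdSimplex (x : α → ℝ) (hx : x ∈ stdSimplex ℝ α) : PMF α :=
  PMF.ofFintype (fun a => ENNReal.ofReal (x a)) (by
    rw [← ENNReal.ofReal_sum_of_nonneg fun a _ => hx.1 a, hx.2, ENNReal.ofReal_one])

theorem PMF.ofStdSimplex_toReal (x : α → ℝ) (hx : x ∈ stdSimplex ℝ α) (a : α) :
    (PMF.ofStdSimplex x hx a).toReal = x a := by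
  rw [PMF.ofStdSimplex, PMF.ofFintype_apply, ENNReal.toReal_ofReal (hx.1 a)]

end FinitePMF

namespace CSG

variable {S A B : Type*} [Fintype S] [Fintype A] [Fintype B]

theorem integral_stageLaw (p : PMF S) (σ : S → PMF A) (τ : S → PMF B) (f : Stage S A B → ℝ) :
    ∫ x, f x ∂(stageLaw p σ τ).toMeasure =
      ∑ s, (p s).toReal * ∑ a, (σ s a).toReal * ∑ b, (τ s b).toReal * f ⟨s, a, b⟩ := by
  have : Fintype (Stage S A B) := Fintype.ofFinite _
  rw [PMF.integral_eq_sum]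
  simp only [smul_eq_mul, stageLaw, PMF.sum_bind, PMF.sum_pure]

section Trajectory

variable (G : CSG S A B) (σ : Strategy S A B A) (τ : Strategy S A B B) (s : S)

instance : IsProbabilityMeasure (G.playMeasure σ τ s) := by
  unfold playMeasure
  infer_instance

theorem integral_playMeasure_zero (f : Stage S A B → ℝ) :
    ∫ ω, f (ω 0) ∂(G.playMeasure σ τ s) =
      ∫ x, f x ∂(stageLaw (PMF.pure s) (σ 0 Fin.elim0) (τ 0 Fin.elim0)).toMeasure := by
  let μ₀ := (stageLaw (PMF.pure s) (σ 0 Fin.elim0) (τ 0 Fin.elim0)).toMeasure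
  have h1 : (G.playMeasure σ τ s).map (Preorder.frestrictLe 0) =
      μ₀.map (MeasurableEquiv.piUnique fun _ : Finset.Iic 0 => Stage S A B).symm := by
    rw [playMeasure, Kernel.trajMeasure, Measure.map_comp _ _ (by fun_prop),
      Kernel.traj_map_frestrictLe, Kernel.partialTraj_self, Measure.id_comp]
  have h2 : ∫ ω, f (ω 0) ∂(G.playMeasure σ τ s) =
      ∫ p, f (p ⟨0, Finset.mem_Iic.2 le_rfl⟩)
        ∂((G.playMeasure σ τ s).map (Preorder.frestrictLe 0)) := by
    rw [integral_map (by fun_prop) (Measurable.of_discrete.aestronglyMeasurable)]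
    rfl
  rw [h2, h1, integral_map (by fun_prop) (Measurable.of_discrete.aestronglyMeasurable)]
  rfl

theorem integral_playMeasure_succ (n : ℕ)
    (f : ((i : Finset.Iic n) → Stage S A B) → Stage S A B → ℝ) :
    ∫ ω, f (Preorder.frestrictLe n ω) (ω (n + 1)) ∂(G.playMeasure σ τ s) =
      ∫ ω, ∫ x, f (Preorder.frestrictLe n ω) x
        ∂(G.stepLaw σ τ n (Preorder.frestrictLe n ω)).toMeasure ∂(G.playMeasure σ τ s) := by
  have h := Kernel.map_frestrictLe_trajMeasure_compProd_eq_map_trajMeasure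
    (X := fun _ => Stage S A B) (κ := G.stepKernel σ τ) (a := n)
    (μ₀ := (stageLaw (PMF.pure s) (σ 0 Fin.elim0) (τ 0 Fin.elim0)).toMeasure)
  change (G.playMeasure σ τ s).map _ ⊗ₘ _ = (G.playMeasure σ τ s).map _ at h
  have h1 : ∫ ω, f (Preorder.frestrictLe n ω) (ω (n + 1)) ∂(G.playMeasure σ τ s) =
      ∫ q, f q.1 q.2 ∂((G.playMeasure σ τ s).map
        fun ω => (Preorder.frestrictLe (π := fun _ => Stage S A B) n ω, ω (n + 1))) := by
    rw [integral_map (by fun_prop) (Measurable.of_discrete.aestronglyMeasurable)]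
  rw [h1, ← h, Measure.integral_compProd Integrable.of_finite,
    integral_map (by fun_prop) (Measurable.of_discrete.aestronglyMeasurable)]
  rfl

end Trajectory

end CSG

namespace CSG

variable {S A B : Type*}

/-- The one-shot matrix game at state `s` with continuation payoff `v`. -/
def shapleyGame [Fintype S] (G : CSG S A B) (r : S → A → B → ℝ) (Lam : S → ℝ) (v : S → ℝ) (s : S) :
    Matrix A B ℝ :=
  Matrix.of fun a b => Lam s * r s a b + (1 - Lam s) * ∑ s', (G.trans s a b s').toReal * v s'

/-- The probability that the play has not stopped before stage `n`. -/
def survival (Lam : S → ℝ) (ω : ℕ → Stage S A B) (n : ℕ) : ℝ :=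
  ∏ j ∈ Finset.range n, (1 - Lam (ω j).state)

/-- The discounted payoff accumulated before stage `n`. -/
def partialPayoff (r : S → A → B → ℝ) (Lam : S → ℝ) (ω : ℕ → Stage S A B) (n : ℕ) : ℝ :=
  ∑ t ∈ Finset.range n, survival Lam ω t *
    (Lam (ω t).state * r (ω t).state (ω t).actOne (ω t).actTwo)

section Payoff

variable {r : S → A → B → ℝ} {Lam : S → ℝ}

theorem survival_congr {ω ω' : ℕ → Stage S A B} {n : ℕ} (h : ∀ t < n, ω t = ω' t) :
    survival Lam ω n = survival Lam ω' n :=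
  Finset.prod_congr rfl fun j hj => by rw [h j (Finset.mem_range.1 hj)]

theorem partialPayoff_congr {ω ω' : ℕ → Stage S A B} {n : ℕ} (h : ∀ t < n, ω t = ω' t) :
    partialPayoff r Lam ω n = partialPayoff r Lam ω' n :=
  Finset.sum_congr rfl fun t ht => by
    rw [survival_congr fun u hu => h u (hu.trans (Finset.mem_range.1 ht)),
      h t (Finset.mem_range.1 ht)]

theorem survival_nonneg (h1 : ∀ s, Lam s ≤ 1) (ω : ℕ → Stage S A B) (n : ℕ) :
    0 ≤ survival Lam ω n :=
  Finset.prod_nonneg fun _ _ => sub_nonneg.2 (h1 _)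

theorem survival_le_pow {l : ℝ} (hl : ∀ s, l ≤ Lam s) (h1 : ∀ s, Lam s ≤ 1)
    (ω : ℕ → Stage S A B) (n : ℕ) : survival Lam ω n ≤ (1 - l) ^ n := by
  calc survival Lam ω n ≤ ∏ _j ∈ Finset.range n, (1 - l) :=
        Finset.prod_le_prod (fun _ _ => sub_nonneg.2 (h1 _)) fun j _ => by linarith [hl (ω j).state]
    _ = _ := by simp

theorem abs_term_le {l R : ℝ} (hl0 : 0 < l) (hl : ∀ s, l ≤ Lam s) (h1 : ∀ s, Lam s ≤ 1)
    (hR : ∀ s a b, |r s a b| ≤ R) (ω : ℕ → Stage S A B) (t : ℕ) :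
    |survival Lam ω t * (Lam (ω t).state * r (ω t).state (ω t).actOne (ω t).actTwo)| ≤
      R * (1 - l) ^ t := by
  have h2 := hR (ω t).state (ω t).actOne (ω t).actTwo
  have h3 := survival_le_pow hl h1 ω t
  have h4 : 0 ≤ Lam (ω t).state := hl0.le.trans (hl _)
  rw [abs_mul, abs_mul, abs_of_nonneg (survival_nonneg h1 ω t), abs_of_nonneg h4, mul_comm R]
  refine mul_le_mul h3 ?_ (by positivity) ((survival_nonneg h1 ω t).trans h3)
  calc _ ≤ 1 * |r (ω t).state (ω t).actOne (ω t).actTwo| :=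
        mul_le_mul_of_nonneg_right (h1 _) (abs_nonneg _)
    _ ≤ R := by rwa [one_mul]

theorem summable_bound {l : ℝ} (R : ℝ) (hl0 : 0 < l) (hl1 : l ≤ 1) :
    Summable fun t : ℕ => R * (1 - l) ^ t :=
  (summable_geometric_of_lt_one (by linarith) (by linarith)).mul_left R

theorem abs_partialPayoff_le {l R : ℝ} (hl0 : 0 < l) (hl1 : l ≤ 1) (hl : ∀ s, l ≤ Lam s)
    (h1 : ∀ s, Lam s ≤ 1) (hR : ∀ s a b, |r s a b| ≤ R) (ω : ℕ → Stage S A B) (n : ℕ) :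
    |partialPayoff r Lam ω n| ≤ ∑' t : ℕ, R * (1 - l) ^ t := by
  have h2 := abs_term_le hl0 hl h1 hR ω
  refine (Finset.abs_sum_le_sum_abs _ _).trans ((Finset.sum_le_sum fun t _ => h2 t).trans ?_)
  exact (summable_bound R hl0 hl1).sum_le_tsum _ fun t _ => (abs_nonneg _).trans (h2 t)

theorem tendsto_partialPayoff {l R : ℝ} (hl0 : 0 < l) (hl1 : l ≤ 1) (hl : ∀ s, l ≤ Lam s)
    (h1 : ∀ s, Lam s ≤ 1) (hR : ∀ s a b, |r s a b| ≤ R) (ω : ℕ → Stage S A B) :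
    Tendsto (partialPayoff r Lam ω) atTop (𝓝 (discPayoff r Lam ω)) :=
  (Summable.of_norm_bounded (summable_bound R hl0 hl1)
    (abs_term_le hl0 hl h1 hR ω)).hasSum.tendsto_sum_nat

theorem abs_discPayoff_le {l R : ℝ} (hl0 : 0 < l) (hl1 : l ≤ 1) (hl : ∀ s, l ≤ Lam s)
    (h1 : ∀ s, Lam s ≤ 1) (hR : ∀ s a b, |r s a b| ≤ R) (ω : ℕ → Stage S A B) :
    |discPayoff r Lam ω| ≤ ∑' t : ℕ, R * (1 - l) ^ t :=
  le_of_tendsto' (tendsto_partialPayoff hl0 hl1 hl h1 hR ω).abs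
    (abs_partialPayoff_le hl0 hl1 hl h1 hR ω)

theorem discPayoff_neg (ω : ℕ → Stage S A B) :
    discPayoff (fun s a b => -r s a b) Lam ω = -discPayoff r Lam ω := by
  rw [discPayoff, discPayoff, ← tsum_neg]
  simp only [mul_neg]

end Payoff

section Submartingale

variable [Fintype S] [Fintype A] [Fintype B] (G : CSG S A B) {r : S → A → B → ℝ} {Lam : S → ℝ}
  {v : S → ℝ}

omit [Fintype S] [Fintype A] [Fintype B] in
theorem measurable_comp_coordinate (f : Stage S A B → ℝ) (n : ℕ) :
    Measurable fun ω : ℕ → Stage S A B => f (ω n) :=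
  Measurable.of_discrete.comp (measurable_pi_apply n)

omit [Fintype S] [Fintype A] [Fintype B] in
theorem measurable_survival (n : ℕ) :
    Measurable fun ω : ℕ → Stage S A B => survival Lam ω n :=
  Finset.measurable_prod _ fun j _ => measurable_comp_coordinate (fun x => 1 - Lam x.state) j

omit [Fintype S] [Fintype A] [Fintype B] in
theorem measurable_partialPayoff (n : ℕ) :
    Measurable fun ω : ℕ → Stage S A B => partialPayoff r Lam ω n :=
  Finset.measurable_sum _ fun t _ => (measurable_survival t).mul
    (measurable_comp_coordinate (fun x => Lam x.state * r x.state x.actOne x.actTwo) t)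

variable (r Lam v) in
/-- The payoff accumulated before stage `n` plus the continuation payoff once the actions of stage
`n` are known. -/
def continuedPayoff (ω : ℕ → Stage S A B) (n : ℕ) : ℝ :=
  partialPayoff r Lam ω n + survival Lam ω n *
    G.shapleyGame r Lam v (ω n).state (ω n).actOne (ω n).actTwo

omit [Fintype A] [Fintype B] in
theorem measurable_continuedPayoff (n : ℕ) :
    Measurable fun ω : ℕ → Stage S A B => G.continuedPayoff r Lam v ω n :=
  (measurable_partialPayoff n).add ((measurable_survival n).mul
    (measurable_comp_coordinate
      (fun x => G.shapleyGame r Lam v x.state x.actOne x.actTwo) n))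

theorem exists_shapleyGame_bound :
    ∃ K : ℝ, 0 ≤ K ∧ ∀ s a b, |G.shapleyGame r Lam v s a b| ≤ K := by
  obtain ⟨K, hK⟩ := (Set.finite_range fun x : S × A × B =>
    |G.shapleyGame r Lam v x.1 x.2.1 x.2.2|).bddAbove
  exact ⟨max K 0, le_max_right _ _, fun s a b => (hK ⟨(s, a, b), rfl⟩).trans (le_max_left _ _)⟩

theorem exists_reward_bound (r : S → A → B → ℝ) : ∃ R : ℝ, 0 ≤ R ∧ ∀ s a b, |r s a b| ≤ R := by
  obtain ⟨K, hK⟩ := (Set.finite_range fun x : S × A × B => |r x.1 x.2.1 x.2.2|).bddAbove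
  exact ⟨max K 0, le_max_right _ _, fun s a b => (hK ⟨(s, a, b), rfl⟩).trans (le_max_left _ _)⟩

theorem exists_discount_bound [Nonempty S] (h0 : ∀ s, 0 < Lam s) :
    ∃ l : ℝ, 0 < l ∧ ∀ s, l ≤ Lam s := by
  obtain ⟨m, hm⟩ := Finite.exists_min Lam
  exact ⟨Lam m, h0 m, hm⟩

omit [Fintype A] [Fintype B] in
theorem abs_continuedPayoff_le {l R K : ℝ} (hl0 : 0 < l) (hl1 : l ≤ 1) (hl : ∀ s, l ≤ Lam s)
    (h1 : ∀ s, Lam s ≤ 1) (hR : ∀ s a b, |r s a b| ≤ R)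
    (hK : ∀ s a b, |G.shapleyGame r Lam v s a b| ≤ K) (ω : ℕ → Stage S A B) (n : ℕ) :
    |G.continuedPayoff r Lam v ω n| ≤ ∑' t : ℕ, R * (1 - l) ^ t + K := by
  refine (abs_add_le _ _).trans (add_le_add (abs_partialPayoff_le hl0 hl1 hl h1 hR ω n) ?_)
  rw [abs_mul, abs_of_nonneg (survival_nonneg h1 ω n)]
  have h2 := survival_le_pow hl h1 ω n
  have h3 : (1 - l) ^ n ≤ 1 := pow_le_one₀ (by linarith) (by linarith)
  have h4 := hK (ω n).state (ω n).actOne (ω n).actTwo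
  calc _ ≤ 1 * |G.shapleyGame r Lam v (ω n).state (ω n).actOne (ω n).actTwo| :=
        mul_le_mul_of_nonneg_right (h2.trans h3) (abs_nonneg _)
    _ ≤ K := by rwa [one_mul]

omit [Fintype A] [Fintype B] in
theorem tendsto_continuedPayoff {l R K : ℝ} (hl0 : 0 < l) (hl1 : l ≤ 1) (hl : ∀ s, l ≤ Lam s)
    (h1 : ∀ s, Lam s ≤ 1) (hR : ∀ s a b, |r s a b| ≤ R)
    (hK : ∀ s a b, |G.shapleyGame r Lam v s a b| ≤ K) (ω : ℕ → Stage S A B) :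
    Tendsto (G.continuedPayoff r Lam v ω) atTop (𝓝 (discPayoff r Lam ω)) := by
  have h2 : Tendsto (fun n => survival Lam ω n *
      G.shapleyGame r Lam v (ω n).state (ω n).actOne (ω n).actTwo) atTop (𝓝 0) := by
    have h3 : Tendsto (fun n : ℕ => (1 - l) ^ n * K) atTop (𝓝 0) := by
      simpa using (tendsto_pow_atTop_nhds_zero_of_lt_one (by linarith : (0 : ℝ) ≤ 1 - l)
        (by linarith)).mul_const K
    refine squeeze_zero_norm (fun n => ?_) h3
    rw [Real.norm_eq_abs, abs_mul, abs_of_nonneg (survival_nonneg h1 ω n)]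
    exact mul_le_mul (survival_le_pow hl h1 ω n) (hK _ _ _) (abs_nonneg _)
      (pow_nonneg (by linarith) n)
  have h3 := (tendsto_partialPayoff hl0 hl1 hl h1 hR ω).add h2
  rwa [add_zero] at h3

theorem le_integral_stageLaw (p : PMF S) {σ : S → PMF A} {τ : S → PMF B}
    (h : ∀ s, v s ≤ ∑ a, (σ s a).toReal * ∑ b, (τ s b).toReal * G.shapleyGame r Lam v s a b) :
    ∑ s, (p s).toReal * v s ≤
      ∫ x, G.shapleyGame r Lam v x.state x.actOne x.actTwo ∂(stageLaw p σ τ).toMeasure := by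
  rw [integral_stageLaw]
  exact Finset.sum_le_sum fun s _ => mul_le_mul_of_nonneg_left (h s) ENNReal.toReal_nonneg

/-- A play that agrees with the given stages up to stage `n`. -/
def extendHistory {n : ℕ} (p : (i : Finset.Iic n) → Stage S A B) (t : ℕ) : Stage S A B :=
  if h : t ≤ n then p ⟨t, Finset.mem_Iic.2 h⟩ else p ⟨n, Finset.mem_Iic.2 le_rfl⟩

omit [Fintype S] [Fintype A] [Fintype B] in
theorem extendHistory_frestrictLe (ω : ℕ → Stage S A B) {n t : ℕ} (ht : t < n + 1) :
    extendHistory (Preorder.frestrictLe (π := fun _ => Stage S A B) n ω) t = ω t := by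
  rw [extendHistory, dif_pos (Nat.lt_succ_iff.1 ht)]
  rfl

theorem integral_continuedPayoff_le_succ (h1 : ∀ s, Lam s ≤ 1)
    {σ : Strategy S A B A} {τ : Strategy S A B B} (s : S)
    (h : ∀ t hist s', v s' ≤ ∑ a, (σ t hist s' a).toReal *
      ∑ b, (τ t hist s' b).toReal * G.shapleyGame r Lam v s' a b)
    {C : ℝ} (hC : ∀ ω n, |G.continuedPayoff r Lam v ω n| ≤ C) (n : ℕ) :
    ∫ ω, G.continuedPayoff r Lam v ω n ∂(G.playMeasure σ τ s) ≤
      ∫ ω, G.continuedPayoff r Lam v ω (n + 1) ∂(G.playMeasure σ τ s) := by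
  let f : ((i : Finset.Iic n) → Stage S A B) → Stage S A B → ℝ := fun p x =>
    partialPayoff r Lam (extendHistory p) (n + 1) + survival Lam (extendHistory p) (n + 1) *
      G.shapleyGame r Lam v x.state x.actOne x.actTwo
  have hf : ∀ ω : ℕ → Stage S A B, G.continuedPayoff r Lam v ω (n + 1) =
      f (Preorder.frestrictLe n ω) (ω (n + 1)) := by
    intro ω
    simp only [f, continuedPayoff]
    rw [partialPayoff_congr fun t ht => extendHistory_frestrictLe ω ht,
      survival_congr fun t ht => extendHistory_frestrictLe ω ht]
  simp only [hf]
  rw [integral_playMeasure_succ]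
  refine integral_mono ?_ ?_ fun ω => ?_
  · exact Integrable.of_bound (G.measurable_continuedPayoff n).aestronglyMeasurable C
      (ae_of_all _ fun ω => hC ω n)
  · obtain ⟨D, hD⟩ := (Set.finite_range fun p : (i : Finset.Iic n) → Stage S A B =>
      ‖∫ x, f p x ∂(G.stepLaw σ τ n p).toMeasure‖).bddAbove
    refine Integrable.of_bound ?_ D (ae_of_all _ fun ω => hD ⟨_, rfl⟩)
    exact ((Measurable.of_discrete (f := fun p : (i : Finset.Iic n) → Stage S A B =>
      ∫ x, f p x ∂(G.stepLaw σ τ n p).toMeasure)).comp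
        (Preorder.measurable_frestrictLe n)).aestronglyMeasurable
  · dsimp only
    have h2 : ∫ x, f (Preorder.frestrictLe n ω) x
        ∂(G.stepLaw σ τ n (Preorder.frestrictLe n ω)).toMeasure =
        partialPayoff r Lam ω (n + 1) + survival Lam ω (n + 1) *
          ∫ x, G.shapleyGame r Lam v x.state x.actOne x.actTwo
            ∂(G.stepLaw σ τ n (Preorder.frestrictLe n ω)).toMeasure := by
      simp only [f]
      rw [integral_add (integrable_const _) Integrable.of_finite, integral_const,
        integral_const_mul, partialPayoff_congr fun t ht => extendHistory_frestrictLe ω ht,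
        survival_congr fun t ht => extendHistory_frestrictLe ω ht]
      simp
    rw [h2]
    have h3 := G.le_integral_stageLaw (v := v) (r := r) (Lam := Lam)
      (G.trans (ω n).state (ω n).actOne (ω n).actTwo)
      (h (n + 1) (fun i => ω i))
    have h4 : G.stepLaw σ τ n (Preorder.frestrictLe n ω) =
        stageLaw (G.trans (ω n).state (ω n).actOne (ω n).actTwo) (σ (n + 1) fun i => ω i)
          (τ (n + 1) fun i => ω i) := rfl
    rw [h4]
    refine le_trans (le_of_eq ?_) (add_le_add_right
      (mul_le_mul_of_nonneg_left h3 (survival_nonneg h1 ω (n + 1))) _)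
    simp only [continuedPayoff, partialPayoff, survival, shapleyGame, Matrix.of_apply,
      Finset.sum_range_succ, Finset.prod_range_succ]
    ring

theorem le_integral_discPayoff (h0 : ∀ s, 0 < Lam s) (h1 : ∀ s, Lam s ≤ 1)
    {σ : Strategy S A B A} {τ : Strategy S A B B} (s : S)
    (h : ∀ t hist s', v s' ≤ ∑ a, (σ t hist s' a).toReal *
      ∑ b, (τ t hist s' b).toReal * G.shapleyGame r Lam v s' a b) :
    v s ≤ ∫ ω, discPayoff r Lam ω ∂(G.playMeasure σ τ s) := by
  have : Nonempty S := ⟨s⟩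
  obtain ⟨l, hl0, hl⟩ := exists_discount_bound h0
  obtain ⟨R, -, hR⟩ := exists_reward_bound r
  obtain ⟨K, -, hK⟩ := G.exists_shapleyGame_bound (r := r) (Lam := Lam) (v := v)
  have hl1 : l ≤ 1 := (hl s).trans (h1 s)
  have hC := G.abs_continuedPayoff_le hl0 hl1 hl h1 hR hK
  have hlim : Tendsto (fun n => ∫ ω, G.continuedPayoff r Lam v ω n ∂(G.playMeasure σ τ s)) atTop
      (𝓝 (∫ ω, discPayoff r Lam ω ∂(G.playMeasure σ τ s))) :=
    tendsto_integral_of_dominated_convergence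
      (fun _ => ∑' t : ℕ, R * (1 - l) ^ t + K)
      (fun n => (G.measurable_continuedPayoff n).aestronglyMeasurable) (integrable_const _)
      (fun n => ae_of_all _ fun ω => hC ω n)
      (ae_of_all _ fun ω => G.tendsto_continuedPayoff hl0 hl1 hl h1 hR hK ω)
  have hmono : Monotone fun n => ∫ ω, G.continuedPayoff r Lam v ω n ∂(G.playMeasure σ τ s) :=
    monotone_nat_of_le_succ (G.integral_continuedPayoff_le_succ h1 s h hC)
  refine le_trans ?_ (hmono.ge_of_tendsto hlim 0)
  have h2 : ∀ ω : ℕ → Stage S A B, G.continuedPayoff r Lam v ω 0 =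
      G.shapleyGame r Lam v (ω 0).state (ω 0).actOne (ω 0).actTwo := by
    intro ω
    simp [continuedPayoff, partialPayoff, survival]
  simp only [h2]
  rw [G.integral_playMeasure_zero σ τ s
    fun x => G.shapleyGame r Lam v x.state x.actOne x.actTwo]
  refine le_trans (le_of_eq ?_) (G.le_integral_stageLaw (PMF.pure s) (h 0 Fin.elim0))
  rw [PMF.sum_pure]

theorem integral_discPayoff_le (h0 : ∀ s, 0 < Lam s) (h1 : ∀ s, Lam s ≤ 1)
    {σ : Strategy S A B A} {τ : Strategy S A B B} (s : S)
    (h : ∀ t hist s', ∑ a, (σ t hist s' a).toReal *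
      ∑ b, (τ t hist s' b).toReal * G.shapleyGame r Lam v s' a b ≤ v s') :
    ∫ ω, discPayoff r Lam ω ∂(G.playMeasure σ τ s) ≤ v s := by
  have h2 := G.le_integral_discPayoff (r := fun s a b => -r s a b) (v := fun s => -v s) h0 h1
    (σ := σ) (τ := τ) s (fun t hist s' => by
      have h3 : ∀ a b, G.shapleyGame (fun s a b => -r s a b) Lam (fun s => -v s) s' a b =
          -G.shapleyGame r Lam v s' a b := by
        intro a b
        simp only [shapleyGame, Matrix.of_apply, mul_neg, Finset.sum_neg_distrib]
        ring
      simp only [h3, mul_neg, Finset.sum_neg_distrib]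
      exact neg_le_neg (h t hist s'))
  simp only [discPayoff_neg, integral_neg] at h2
  linarith

end Submartingale

end CSG

namespace CSG

variable {S A B : Type*} [Fintype S] [Fintype A] [Fintype B] (G : CSG S A B)
  {r : S → A → B → ℝ} {Lam : S → ℝ}

section Value

variable [Nonempty A] [Nonempty B]

theorem exists_shapley_fixedPoint (r : S → A → B → ℝ) (h0 : ∀ s, 0 < Lam s)
    (h1 : ∀ s, Lam s ≤ 1) : ∃ v : S → ℝ, ∀ s, matrixVal (G.shapleyGame r Lam v s) = v s := by
  rcases isEmpty_or_nonempty S with hS | hS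
  · exact ⟨0, fun s => hS.elim s⟩
  obtain ⟨l, hl0, hl⟩ := exists_discount_bound h0
  have hl1 : 0 ≤ 1 - l := sub_nonneg.2 ((hl (Classical.arbitrary S)).trans (h1 _))
  let T : (S → ℝ) → S → ℝ := fun v s => matrixVal (G.shapleyGame r Lam v s)
  have hT : ∀ u v s, T u s ≤ T v s + (1 - l) * dist u v := by
    intro u v s
    refine matrixVal_le_add fun a b => ?_
    have h2 : ∑ s', (G.trans s a b s').toReal * (u s' - v s') ≤ dist u v :=
      stdSimplex_sum_le (G.trans s a b).toReal_mem_stdSimplex fun s' =>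
        (le_abs_self _).trans (dist_le_pi_dist u v s')
    have h3 := mul_le_mul_of_nonneg_left h2 (sub_nonneg.2 (h1 s))
    have h4 : (1 - Lam s) * dist u v ≤ (1 - l) * dist u v :=
      mul_le_mul_of_nonneg_right (by linarith [hl s]) dist_nonneg
    simp only [mul_sub, Finset.sum_sub_distrib] at h3
    simp only [shapleyGame, Matrix.of_apply]
    linarith
  have hc : ContractingWith (1 - l).toNNReal T := by
    refine ⟨?_, LipschitzWith.of_dist_le_mul fun u v => ?_⟩
    · rw [Real.toNNReal_lt_one]
      linarith
    · rw [Real.coe_toNNReal _ hl1]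
      refine (dist_pi_le_iff (mul_nonneg hl1 dist_nonneg)).2 fun s => ?_
      rw [Real.dist_eq, abs_le]
      have h2 := hT u v s
      have h3 := hT v u s
      rw [dist_comm v u] at h3
      constructor <;> linarith
  exact ⟨hc.fixedPoint, fun s => congrFun hc.fixedPoint_isFixedPt s⟩

theorem discVal_eq (h0 : ∀ s, 0 < Lam s) (h1 : ∀ s, Lam s ≤ 1) {v : S → ℝ}
    (hv : ∀ s, matrixVal (G.shapleyGame r Lam v s) = v s) (s : S) :
    G.discVal r Lam s = v s := by
  have : Nonempty S := ⟨s⟩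
  obtain ⟨l, hl0, hl⟩ := exists_discount_bound h0
  obtain ⟨R, -, hR⟩ := exists_reward_bound r
  have hl1 : l ≤ 1 := (hl s).trans (h1 s)
  have hbound : ∀ σ τ, |∫ ω, discPayoff r Lam ω ∂(G.playMeasure σ τ s)| ≤
      ∑' t : ℕ, R * (1 - l) ^ t := fun σ τ => by
    have h2 := norm_integral_le_of_norm_le_const (μ := G.playMeasure σ τ s)
      (ae_of_all _ fun ω => (Real.norm_eq_abs _).trans_le (abs_discPayoff_le hl0 hl1 hl h1 hR ω))
    simpa using h2
  choose x hx hxv using fun s => exists_optimal_row (G.shapleyGame r Lam v s)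
  choose y hy hyv using fun s => exists_optimal_col (G.shapleyGame r Lam v s)
  let σ₀ : Strategy S A B A := fun _ _ s => PMF.ofStdSimplex (x s) (hx s)
  let τ₀ : Strategy S A B B := fun _ _ s => PMF.ofStdSimplex (y s) (hy s)
  have hσ₀ : ∀ τ, v s ≤ ∫ ω, discPayoff r Lam ω ∂(G.playMeasure σ₀ τ s) := by
    intro τ
    refine G.le_integral_discPayoff h0 h1 s fun t hist s' => ?_
    simp only [σ₀, PMF.ofStdSimplex_toReal, Finset.mul_sum]
    rw [Finset.sum_comm]
    simp only [mul_left_comm (x s' _), ← Finset.mul_sum]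
    exact stdSimplex_le_sum (PMF.toReal_mem_stdSimplex _) fun b => by
      rw [← hv s']
      exact hxv s' b
  have hτ₀ : ∀ σ, ∫ ω, discPayoff r Lam ω ∂(G.playMeasure σ τ₀ s) ≤ v s := by
    intro σ
    refine G.integral_discPayoff_le h0 h1 s fun t hist s' => ?_
    simp only [τ₀, PMF.ofStdSimplex_toReal]
    refine stdSimplex_sum_le (PMF.toReal_mem_stdSimplex _) fun a => ?_
    simp only [mul_comm (y s' _)]
    rw [← hv s']
    exact hyv s' a
  have hbelow : ∀ σ, BddBelow (Set.range fun τ : Strategy S A B B =>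
      ∫ ω, discPayoff r Lam ω ∂(G.playMeasure σ τ s)) := fun σ =>
    ⟨-∑' t : ℕ, R * (1 - l) ^ t, by rintro _ ⟨τ, rfl⟩; exact (abs_le.1 (hbound σ τ)).1⟩
  have hle : ∀ σ, ⨅ τ : Strategy S A B B, ∫ ω, discPayoff r Lam ω ∂(G.playMeasure σ τ s) ≤ v s :=
    fun σ => (ciInf_le (hbelow σ) τ₀).trans (hτ₀ σ)
  have : Nonempty (Strategy S A B A) := ⟨σ₀⟩
  have : Nonempty (Strategy S A B B) := ⟨τ₀⟩
  refine le_antisymm (ciSup_le hle) ?_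
  exact le_ciSup_of_le ⟨v s, by rintro _ ⟨σ, rfl⟩; exact hle σ⟩ σ₀ (le_ciInf hσ₀)

theorem abs_discVal_le {R : ℝ} (hR : ∀ s a b, |r s a b| ≤ R) (h0 : ∀ s, 0 < Lam s)
    (h1 : ∀ s, Lam s ≤ 1) (s : S) : |G.discVal r Lam s| ≤ R := by
  classical
  have : Nonempty S := ⟨s⟩
  obtain ⟨v, hv⟩ := G.exists_shapley_fixedPoint r h0 h1
  rw [G.discVal_eq h0 h1 hv, abs_le]
  constructor
  · obtain ⟨m, hm⟩ := Finite.exists_min v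
    refine le_trans ?_ (hm s)
    have h2 : Lam m * (-R) + (1 - Lam m) * v m ≤ v m := by
      conv_rhs => rw [← hv m]
      refine le_matrixVal (single_mem_stdSimplex ℝ (Classical.arbitrary A)) fun b =>
        stdSimplex_le_sum (single_mem_stdSimplex ℝ _) fun a => ?_
      exact add_le_add (mul_le_mul_of_nonneg_left (abs_le.1 (hR m a b)).1 (h0 m).le)
        (mul_le_mul_of_nonneg_left
          (stdSimplex_le_sum (G.trans m a b).toReal_mem_stdSimplex hm) (sub_nonneg.2 (h1 m)))
    exact le_of_mul_le_mul_left (by linarith) (h0 m)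
  · obtain ⟨m, hm⟩ := Finite.exists_max v
    refine (hm s).trans ?_
    have h2 : v m ≤ Lam m * R + (1 - Lam m) * v m := by
      conv_lhs => rw [← hv m]
      refine matrixVal_le (single_mem_stdSimplex ℝ (Classical.arbitrary B)) fun a => ?_
      rw [Finset.sum_congr rfl fun b _ => mul_comm _ _]
      refine stdSimplex_sum_le (single_mem_stdSimplex ℝ _) fun b => ?_
      exact add_le_add (mul_le_mul_of_nonneg_left (abs_le.1 (hR m a b)).2 (h0 m).le)
        (mul_le_mul_of_nonneg_left
          (stdSimplex_sum_le (G.trans m a b).toReal_mem_stdSimplex hm) (sub_nonneg.2 (h1 m)))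
    exact le_of_mul_le_mul_left (by linarith) (h0 m)

end Value

section Auxiliary

variable [DecidableEq S]

/-- The transition matrix under pure stationary strategies. -/
def pureTrans (σ : S → A) (τ : S → B) : Matrix S S ℝ :=
  Matrix.of fun s s' => (G.trans s (σ s) (τ s) s').toReal

omit [Fintype S] [DecidableEq S] in
theorem transMatrix_pure (σ : S → A) (τ : S → B) :
    G.transMatrix (fun s => PMF.pure (σ s)) (fun s => PMF.pure (τ s)) = G.pureTrans σ τ := by
  ext s s'
  simp only [transMatrix, Matrix.of_apply, mul_assoc, ← Finset.mul_sum, pureTrans]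
  rw [PMF.sum_pure (σ s) fun a => ∑ b, (PMF.pure (τ s) b).toReal * (G.trans s a b s').toReal,
    PMF.sum_pure (τ s) fun b => (G.trans s (σ s) b s').toReal]

omit [Fintype S] [DecidableEq S] in
theorem stageReward_pure (σ : S → A) (τ : S → B) (s : S) :
    stageReward r (fun s => PMF.pure (σ s)) (fun s => PMF.pure (τ s)) s = r s (σ s) (τ s) := by
  simp only [stageReward, mul_assoc, ← Finset.mul_sum]
  rw [PMF.sum_pure (σ s) fun a => ∑ b, (PMF.pure (τ s) b).toReal * r s a b,
    PMF.sum_pure (τ s) fun b => r s (σ s) b]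

theorem auxGame_apply (s : S) (z : ℝ) (σ : S → A) (τ : S → B) :
    G.auxGame r Lam s z σ τ =
      ((discountedMatrix Lam (G.pureTrans σ τ)).updateCol s
        fun s' => Lam s' * r s' (σ s') (τ s')).det -
      z * (discountedMatrix Lam (G.pureTrans σ τ)).det := by
  simp only [auxGame, nablaAt, nabla, discMatrix, Matrix.of_apply, transMatrix_pure,
    stageReward_pure, discountedMatrix]

variable [Nonempty A] [Nonempty B]

theorem prod_mul_le_matrixVal_auxGame (h0 : ∀ s, 0 < Lam s) (h1 : ∀ s, Lam s ≤ 1) {s : S} {z : ℝ}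
    (hz : z ≤ G.discVal r Lam s) :
    (∏ s, Lam s) * (G.discVal r Lam s - z) ≤ matrixVal (G.auxGame r Lam s z) := by
  obtain ⟨v, hv⟩ := G.exists_shapley_fixedPoint r h0 h1
  rw [G.discVal_eq h0 h1 hv] at hz ⊢
  choose x hx hxv using fun s => exists_optimal_row (G.shapleyGame r Lam v s)
  refine le_matrixVal (prod_mem_stdSimplex hx) fun τ => ?_
  simp only [auxGame_apply]
  exact prod_mul_le_mixture (Q := fun s a s' => (G.trans s a (τ s) s').toReal)
    (g := fun s a => Lam s * r s a (τ s)) h0 h1 hx (fun s a s' => ENNReal.toReal_nonneg)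
    (fun s a => (G.trans s a (τ s)).toReal_mem_stdSimplex.2)
    (fun s => (hv s).symm.le.trans (hxv s (τ s))) hz

theorem matrixVal_auxGame_le_prod_mul (h0 : ∀ s, 0 < Lam s) (h1 : ∀ s, Lam s ≤ 1) {s : S} {z : ℝ}
    (hz : G.discVal r Lam s ≤ z) :
    matrixVal (G.auxGame r Lam s z) ≤ (∏ s, Lam s) * (G.discVal r Lam s - z) := by
  obtain ⟨v, hv⟩ := G.exists_shapley_fixedPoint r h0 h1
  rw [G.discVal_eq h0 h1 hv] at hz ⊢
  choose y hy hyv using fun s => exists_optimal_col (G.shapleyGame r Lam v s)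
  refine matrixVal_le (prod_mem_stdSimplex hy) fun σ => ?_
  simp only [auxGame_apply, mul_comm _ (∏ s, y s _)]
  refine mixture_le_prod_mul (Q := fun s b s' => (G.trans s (σ s) b s').toReal)
    (g := fun s b => Lam s * r s (σ s) b) h0 h1 hy (fun s a s' => ENNReal.toReal_nonneg)
    (fun s b => (G.trans s (σ s) b).toReal_mem_stdSimplex.2) (fun s => ?_) hz
  simp only [mul_comm (y s _)]
  exact (hyv s (σ s)).trans (hv s).le

theorem le_discVal_iff (h0 : ∀ s, 0 < Lam s) (h1 : ∀ s, Lam s ≤ 1) {s : S} {z : ℝ} :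
    z ≤ G.discVal r Lam s ↔ 0 ≤ matrixVal (G.auxGame r Lam s z) := by
  have hp : 0 < ∏ s, Lam s := Finset.prod_pos fun s _ => h0 s
  refine ⟨fun h => le_trans (mul_nonneg hp.le (sub_nonneg.2 h))
    (G.prod_mul_le_matrixVal_auxGame h0 h1 h), fun h => ?_⟩
  by_contra! hlt
  have h2 := G.matrixVal_auxGame_le_prod_mul h0 h1 hlt.le
  have h3 := mul_neg_of_pos_of_neg hp (sub_neg.2 hlt)
  linarith

end Auxiliary

end CSG

section Decided

/-- The truth value of `P` is eventually constant along `l`. -/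
def EventuallyDecided {α : Type*} (l : Filter α) (P : α → Prop) : Prop :=
  (∀ᶠ x in l, P x) ∨ ∀ᶠ x in l, ¬ P x

namespace EventuallyDecided

variable {α : Type*} {l : Filter α} {P Q : α → Prop}

theorem congr (hP : EventuallyDecided l P) (h : ∀ᶠ x in l, P x ↔ Q x) : EventuallyDecided l Q := by
  rcases hP with hP | hP
  · exact Or.inl (by filter_upwards [hP, h] with x h1 h2 using h2.1 h1)
  · exact Or.inr (by filter_upwards [hP, h] with x h1 h2 using fun h3 => h1 (h2.2 h3))

theorem not (hP : EventuallyDecided l P) : EventuallyDecided l fun x => ¬ P x := by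
  rcases hP with hP | hP
  · exact Or.inr (by filter_upwards [hP] with x h using not_not.2 h)
  · exact Or.inl hP

theorem and (hP : EventuallyDecided l P) (hQ : EventuallyDecided l Q) :
    EventuallyDecided l fun x => P x ∧ Q x := by
  rcases hP with hP | hP
  · exact hQ.congr (by filter_upwards [hP] with x h using by simp [h])
  · exact Or.inr (by filter_upwards [hP] with x h using fun h' => h h'.1)

theorem forall_finite {ι : Type*} [Finite ι] {R : ι → α → Prop}
    (h : ∀ i, EventuallyDecided l (R i)) : EventuallyDecided l fun x => ∀ i, R i x := by
  by_cases h' : ∀ i, ∀ᶠ x in l, R i x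
  · exact Or.inl (eventually_all.2 h')
  · obtain ⟨i, hi⟩ := not_forall.1 h'
    have h2 := (h i).resolve_left hi
    exact Or.inr (by filter_upwards [h2] with x hx using fun h3 => hx (h3 i))

theorem exists_finite {ι : Type*} [Finite ι] {R : ι → α → Prop}
    (h : ∀ i, EventuallyDecided l (R i)) : EventuallyDecided l fun x => ∃ i, R i x :=
  (forall_finite fun i => (h i).not).not.congr (Eventually.of_forall fun x => by simp)

end EventuallyDecided

theorem exists_tendsto_of_eventuallyDecided {α : Type*} {l : Filter α} {f : α → EReal}
    (h : ∀ q : ℝ, EventuallyDecided l fun x => (q : EReal) ≤ f x) : ∃ L, Tendsto f l (𝓝 L) := by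
  refine ⟨sSup {a : EReal | ∃ q : ℝ, a = q ∧ ∀ᶠ x in l, (q : EReal) ≤ f x}, ?_⟩
  refine tendsto_order.2 ⟨fun a ha => ?_, fun a ha => ?_⟩
  · obtain ⟨_, ⟨q, rfl, hq⟩, haq⟩ := lt_sSup_iff.1 ha
    filter_upwards [hq] with x hx using haq.trans_le hx
  · obtain ⟨q, hLq, hqa⟩ := EReal.lt_iff_exists_real_btwn.1 ha
    rcases h q with hq | hq
    · exact absurd (le_sSup (s := {a : EReal | ∃ q : ℝ, a = q ∧ ∀ᶠ x in l, (q : EReal) ≤ f x})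
        ⟨q, rfl, hq⟩) hLq.not_ge
    · filter_upwards [hq] with x hx using (not_le.1 hx).trans hqa

end Decided

section IteratedFilter

/-- The filter along which `x_0 → 0⁺`, `x_1 → 0⁺`, …, each variable tending to zero with all the
previous ones held fixed. -/
def iteratedFilter : (k : ℕ) → Filter (Fin k → ℝ)
  | 0 => pure Fin.elim0
  | k + 1 => (𝓝[>] (0 : ℝ)).bind fun x => (iteratedFilter k).map (Fin.cons x)

theorem eventually_iteratedFilter_succ {k : ℕ} {P : (Fin (k + 1) → ℝ) → Prop} :
    (∀ᶠ y in iteratedFilter (k + 1), P y) ↔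
      ∀ᶠ x in 𝓝[>] (0 : ℝ), ∀ᶠ y in iteratedFilter k, P (Fin.cons x y) := by
  rw [iteratedFilter, eventually_bind]
  simp only [eventually_map]

instance iteratedFilter_neBot (k : ℕ) : (iteratedFilter k).NeBot := by
  induction k with
  | zero => rw [iteratedFilter]; infer_instance
  | succ k ih =>
    refine ⟨fun h => ?_⟩
    have h2 : ∀ᶠ _y in iteratedFilter (k + 1), False := by rw [h]; exact eventually_bot
    rw [eventually_iteratedFilter_succ] at h2
    obtain ⟨x, hx⟩ := h2.exists
    exact hx.exists.choose_spec

theorem eventually_mem_Ioo (k : ℕ) :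
    ∀ᶠ y in iteratedFilter k, ∀ i, y i ∈ Set.Ioo (0 : ℝ) 1 := by
  induction k with
  | zero => exact Eventually.of_forall fun y i => i.elim0
  | succ k ih =>
    rw [eventually_iteratedFilter_succ]
    filter_upwards [Ioo_mem_nhdsGT (zero_lt_one (α := ℝ))] with x hx
    filter_upwards [ih] with y hy
    exact Fin.cons hx hy

theorem tendsto_iteratedFilter_succ {k : ℕ} {X : Type*} [TopologicalSpace X]
    {f : (Fin (k + 1) → ℝ) → X} {a : X}
    (h : ∀ᶠ x in 𝓝[>] (0 : ℝ), Tendsto (fun y => f (Fin.cons x y)) (iteratedFilter k) (𝓝 a)) :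
    Tendsto f (iteratedFilter (k + 1)) (𝓝 a) := by
  intro U hU
  change ∀ᶠ y in iteratedFilter (k + 1), f y ∈ U
  rw [eventually_iteratedFilter_succ]
  filter_upwards [h] with x hx using hx hU

theorem tendsto_zpow_nhdsGT {n : ℤ} (hn : 0 < n) :
    Tendsto (fun x : ℝ => x ^ n) (𝓝[>] 0) (𝓝 0) := by
  lift n to ℕ using hn.le
  have h2 : Tendsto (fun x : ℝ => x ^ n) (𝓝 0) (𝓝 (0 ^ n)) := (continuous_pow n).tendsto 0
  rw [zero_pow (by omega)] at h2
  simpa using h2.mono_left nhdsWithin_le_nhds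

/-- Along the iterated filter, every nonconstant Laurent monomial or its inverse tends to zero. -/
theorem tendsto_monomial_or {k : ℕ} {e : Fin k → ℤ} (he : e ≠ 0) :
    Tendsto (fun y => ∏ i, y i ^ e i) (iteratedFilter k) (𝓝 0) ∨
      Tendsto (fun y => ∏ i, y i ^ (-e i)) (iteratedFilter k) (𝓝 0) := by
  induction k with
  | zero => exact absurd (Subsingleton.elim e 0) he
  | succ k ih =>
    have key : ∀ e : Fin (k + 1) → ℤ,
        Tendsto (fun y => ∏ i, y i ^ (e ∘ Fin.succ) i) (iteratedFilter k) (𝓝 0) →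
        Tendsto (fun y => ∏ i, y i ^ e i) (iteratedFilter (k + 1)) (𝓝 0) := by
      intro e h
      refine tendsto_iteratedFilter_succ (Eventually.of_forall fun x => ?_)
      simp only [Fin.prod_univ_succ, Fin.cons_zero, Fin.cons_succ]
      simpa using h.const_mul (x ^ e 0)
    by_cases h0 : e ∘ Fin.succ = 0
    · have h1 : ∀ i : Fin k, e i.succ = 0 := fun i => congrFun h0 i
      have h2 : e 0 ≠ 0 := fun h => he (funext (Fin.cases h h1))
      have key2 : ∀ n : ℤ, 0 < n → ∀ e : Fin (k + 1) → ℤ, e 0 = n → (∀ i : Fin k, e i.succ = 0) →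
          Tendsto (fun y => ∏ i, y i ^ e i) (iteratedFilter (k + 1)) (𝓝 0) := by
        intro n hn e hen he0 U hU
        change ∀ᶠ y in iteratedFilter (k + 1), _ ∈ U
        rw [eventually_iteratedFilter_succ]
        filter_upwards [tendsto_zpow_nhdsGT hn hU] with x hx
        refine Eventually.of_forall fun y => ?_
        simpa [Fin.prod_univ_succ, he0, hen] using hx
      rcases lt_or_gt_of_ne h2 with h3 | h3
      · exact Or.inr (key2 (-e 0) (by omega) (fun i => -e i) rfl fun i => by simp [h1])
      · exact Or.inl (key2 (e 0) h3 e rfl h1)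
    · exact (ih h0).imp (key e) (key fun i => -e i)

theorem exists_dominant_exponent {k : ℕ} {s : Finset (Fin k →₀ ℕ)} (hs : s.Nonempty) :
    ∃ m₀ ∈ s, ∀ m ∈ s, m ≠ m₀ →
      Tendsto (fun y => ∏ i, y i ^ ((m i : ℤ) - m₀ i)) (iteratedFilter k) (𝓝 0) := by
  classical
  induction hs using Finset.Nonempty.cons_induction with
  | singleton a => exact ⟨a, by simp, fun m hm hne => absurd (Finset.mem_singleton.1 hm) hne⟩
  | cons a s ha hs ih =>
    obtain ⟨m₀, hm₀, h⟩ := ih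
    have hne : (fun i => (a i : ℤ) - m₀ i) ≠ 0 := by
      intro h0
      refine ha ?_
      have : a = m₀ := by
        ext i
        have := congrFun h0 i
        simp only [Pi.zero_apply] at this
        omega
      rwa [this]
    rcases tendsto_monomial_or hne with h1 | h1
    · refine ⟨m₀, by simp [hm₀], fun m hm hmne => ?_⟩
      rcases Finset.mem_cons.1 hm with rfl | hm
      · exact h1
      · exact h m hm hmne
    · simp only [neg_sub] at h1
      refine ⟨a, by simp, fun m hm hmne => ?_⟩
      have hm := (Finset.mem_cons.1 hm).resolve_left hmne
      by_cases hmm : m = m₀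
      · rwa [hmm]
      · have h2 := (h m hm hmm).mul h1
        rw [mul_zero] at h2
        refine h2.congr' ?_
        filter_upwards [eventually_mem_Ioo k] with y hy
        rw [← Finset.prod_mul_distrib]
        refine Finset.prod_congr rfl fun i _ => ?_
        rw [← zpow_add₀ (hy i).1.ne']
        congr 1
        ring

theorem exists_leading_term {k : ℕ} {p : MvPolynomial (Fin k) ℝ} (hp : p ≠ 0) :
    ∃ c : ℝ, c ≠ 0 ∧ ∃ m : Fin k → ℤ,
      Tendsto (fun y => MvPolynomial.eval y p * ∏ i, y i ^ m i) (iteratedFilter k) (𝓝 c) := by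
  obtain ⟨m₀, hm₀, h⟩ := exists_dominant_exponent (MvPolynomial.support_nonempty.2 hp)
  refine ⟨p.coeff m₀, MvPolynomial.mem_support_iff.1 hm₀, fun i => -(m₀ i : ℤ), ?_⟩
  have h2 : Tendsto (fun y : Fin k → ℝ => ∑ m ∈ p.support,
      p.coeff m * ∏ i, y i ^ ((m i : ℤ) - m₀ i)) (iteratedFilter k)
      (𝓝 (∑ m ∈ p.support, if m = m₀ then p.coeff m₀ else 0)) := by
    refine tendsto_finsetSum _ fun m hm => ?_
    by_cases hmm : m = m₀
    · simp [hmm]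
    · simpa [hmm] using (h m hm hmm).const_mul (p.coeff m)
  rw [Finset.sum_ite_eq' p.support m₀, if_pos hm₀] at h2
  refine h2.congr' ?_
  filter_upwards [eventually_mem_Ioo k] with y hy
  rw [MvPolynomial.eval_eq', Finset.sum_mul]
  refine Finset.sum_congr rfl fun m _ => ?_
  rw [mul_assoc, ← Finset.prod_mul_distrib]
  congr 1
  refine Finset.prod_congr rfl fun i _ => ?_
  rw [← zpow_natCast, ← zpow_add₀ (hy i).1.ne', sub_eq_add_neg]

theorem eventuallyDecided_eval_nonneg {k : ℕ} (p : MvPolynomial (Fin k) ℝ) :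
    EventuallyDecided (iteratedFilter k) fun y => 0 ≤ MvPolynomial.eval y p := by
  by_cases hp : p = 0
  · exact Or.inl (Eventually.of_forall fun y => by simp [hp])
  obtain ⟨c, hc, m, hm⟩ := exists_leading_term hp
  have hpos : ∀ᶠ y in iteratedFilter k, 0 < ∏ i, y i ^ m i := by
    filter_upwards [eventually_mem_Ioo k] with y hy
    exact Finset.prod_pos fun i _ => zpow_pos (hy i).1 _
  rcases lt_or_gt_of_ne hc with hc | hc
  · right
    filter_upwards [hm.eventually_lt_const hc, hpos] with y h1 h2 h3
    exact (mul_nonneg h3 h2.le).not_gt h1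
  · left
    filter_upwards [hm.eventually_const_lt hc, hpos] with y h1 h2
    exact (pos_of_mul_pos_left h1 h2.le).le

theorem eventuallyDecided_eval_eq {k : ℕ} (p q : MvPolynomial (Fin k) ℝ) :
    EventuallyDecided (iteratedFilter k) fun y =>
      MvPolynomial.eval y p = MvPolynomial.eval y q :=
  ((eventuallyDecided_eval_nonneg (p - q)).and (eventuallyDecided_eval_nonneg (q - p))).congr
    (Eventually.of_forall fun y => by
      simp only [map_sub, sub_nonneg]
      exact ⟨fun h => le_antisymm h.2 h.1, fun h => ⟨h.ge, h.le⟩⟩)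

end IteratedFilter

section LinearSystem

variable {m n : Type*} [Fintype m] [Fintype n] [DecidableEq n]

section CommRing

variable {R R' : Type*} [CommRing R] [CommRing R']

/-- The columns of `B` with indices in `T`. -/
def columnsIn (B : Matrix m n R) (T : Finset n) : Matrix m T R :=
  B.submatrix id Subtype.val

/-- The Gram matrix of the columns of `B` with indices in `T`. -/
def gramOn (B : Matrix m n R) (T : Finset n) : Matrix T T R :=
  (columnsIn B T).transpose * columnsIn B T

/-- The Cramer numerators of the normal equations for the columns with indices in `T`. -/
def normalNumerator (B : Matrix m n R) (b : m → R) (T : Finset n) : T → R :=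
  (gramOn B T).adjugate.mulVec ((columnsIn B T).transpose.mulVec b)

omit [Fintype n] [DecidableEq n] in
theorem gramOn_map (φ : R →+* R') (B : Matrix m n R) (T : Finset n) :
    gramOn (B.map φ) T = (gramOn B T).map φ := by
  rw [gramOn, gramOn, Matrix.map_mul]
  rfl

omit [Fintype n] in
theorem det_gramOn_map (φ : R →+* R') (B : Matrix m n R) (T : Finset n) :
    (gramOn (B.map φ) T).det = φ (gramOn B T).det := by
  rw [gramOn_map, RingHom.map_det]
  rfl

omit [Fintype n] in
theorem normalNumerator_map (φ : R →+* R') (B : Matrix m n R) (b : m → R) (T : Finset n) (t : T) :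
    normalNumerator (B.map φ) (φ ∘ b) T t = φ (normalNumerator B b T t) := by
  have h1 : (columnsIn (B.map φ) T).transpose = (columnsIn B T).transpose.map φ := rfl
  have h2 : (gramOn (B.map φ) T).adjugate = (gramOn B T).adjugate.map φ := by
    rw [gramOn_map]
    exact (RingHom.map_adjugate φ _).symm
  rw [normalNumerator, normalNumerator, h1, h2, RingHom.map_mulVec]
  congr 2
  ext t
  exact (RingHom.map_mulVec φ _ _ t).symm

end CommRing

/-- The columns in `T` are independent and carry a nonnegative solution of `B w = b`. -/
def IsBasicFeasible (B : Matrix m n ℝ) (b : m → ℝ) (T : Finset n) : Prop :=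
  (gramOn B T).det ≠ 0 ∧
    (∀ t, 0 ≤ (gramOn B T).det * normalNumerator B b T t) ∧
    ∀ i, (columnsIn B T).mulVec (normalNumerator B b T) i = (gramOn B T).det * b i

omit [Fintype m] [DecidableEq n] in
theorem mulVec_eq_columnsIn {B : Matrix m n ℝ} {T : Finset n} {w : n → ℝ}
    (hw : ∀ i, i ∉ T → w i = 0) : B.mulVec w = (columnsIn B T).mulVec fun t => w t := by
  ext j
  simp only [Matrix.mulVec, dotProduct, columnsIn, Matrix.submatrix_apply, id]
  rw [Finset.sum_coe_sort T fun i => B j i * w i]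
  exact (Finset.sum_subset (Finset.subset_univ T) fun i _ hi => by rw [hw i hi, mul_zero]).symm

omit [Fintype m] [DecidableEq n] in
theorem exists_independent_solution {B : Matrix m n ℝ} {b : m → ℝ} (k : ℕ) :
    ∀ w : n → ℝ, 0 ≤ w → B.mulVec w = b → (Finset.univ.filter fun i => w i ≠ 0).card = k →
      ∃ w : n → ℝ, 0 ≤ w ∧ B.mulVec w = b ∧
        ∀ u : n → ℝ, (∀ i, w i = 0 → u i = 0) → B.mulVec u = 0 → u = 0 := by
  induction k using Nat.strong_induction_on with
  | _ k ih =>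
    intro w hw hB hk
    by_cases h : ∀ u : n → ℝ, (∀ i, w i = 0 → u i = 0) → B.mulVec u = 0 → u = 0
    · exact ⟨w, hw, hB, h⟩
    have hpos : ∃ u : n → ℝ, (∀ i, w i = 0 → u i = 0) ∧ B.mulVec u = 0 ∧ ∃ i, 0 < u i := by
      push Not at h
      obtain ⟨u, hu, hBu, hne⟩ := h
      obtain ⟨i, hi⟩ := Function.ne_iff.1 hne
      rcases lt_or_gt_of_ne hi with hlt | hgt
      · exact ⟨-u, fun j hj => by simp [hu j hj], by rw [Matrix.mulVec_neg, hBu, neg_zero], i,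
          by simpa using hlt⟩
      · exact ⟨u, hu, hBu, i, hgt⟩
    obtain ⟨u, hu, hBu, i, hi⟩ := hpos
    obtain ⟨j, hj, hmin⟩ := Finset.exists_min_image (Finset.univ.filter fun i => 0 < u i)
      (fun i => w i / u i) ⟨i, by simpa using hi⟩
    have huj : 0 < u j := by simpa using hj
    have hwj : w j ≠ 0 := fun h0 => huj.ne' (hu j h0)
    refine ih _ ?_ (w - (w j / u j) • u) (fun a => ?_) ?_ rfl
    · rw [← hk]
      refine Finset.card_lt_card (Finset.ssubset_iff_of_subset ?_ |>.2 ⟨j, by simpa using hwj, ?_⟩)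
      · intro a ha
        simp only [Finset.mem_filter, Finset.mem_univ, true_and] at ha ⊢
        exact fun h0 => ha (by simp [h0, hu a h0])
      · simp [huj.ne']
    · simp only [Pi.zero_apply, Pi.sub_apply, Pi.smul_apply, smul_eq_mul, sub_nonneg]
      rcases lt_or_ge 0 (u a) with hua | hua
      · exact (le_div_iff₀ hua).1 (hmin a (by simpa using hua))
      · exact (mul_nonpos_of_nonneg_of_nonpos (div_nonneg (hw j) huj.le) hua).trans (hw a)
    · rw [Matrix.mulVec_sub, Matrix.mulVec_smul, hBu, smul_zero, sub_zero, hB]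

theorem exists_nonneg_solution_iff {B : Matrix m n ℝ} {b : m → ℝ} :
    (∃ w : n → ℝ, 0 ≤ w ∧ B.mulVec w = b) ↔ ∃ T, IsBasicFeasible B b T := by
  constructor
  · rintro ⟨w, hw, hB⟩
    obtain ⟨w, hw, hB, hind⟩ := exists_independent_solution _ w hw hB rfl
    let T : Finset n := Finset.univ.filter fun i => w i ≠ 0
    have hwT : ∀ i, i ∉ T → w i = 0 := fun i hi => by simpa [T] using hi
    rw [mulVec_eq_columnsIn hwT] at hB
    have hdet : (gramOn B T).det ≠ 0 := by
      intro h0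
      obtain ⟨u, hu, hGu⟩ := Matrix.exists_mulVec_eq_zero_iff.2 h0
      have hBu : (columnsIn B T).mulVec u = 0 := by
        have h2 : u ∈ LinearMap.ker (Matrix.mulVecLin (gramOn B T)) := hGu
        rw [gramOn, Matrix.ker_mulVecLin_transpose_mul_self] at h2
        exact h2
      let u' : n → ℝ := fun i => if h : i ∈ T then u ⟨i, h⟩ else 0
      have hu'T : ∀ i, i ∉ T → u' i = 0 := fun i hi => dif_neg hi
      have hu' : (fun t : T => u' t) = u := funext fun t => dif_pos t.2
      have h3 := hind u' (fun i hi => hu'T i (by simpa [T] using hi)) (by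
        rw [mulVec_eq_columnsIn hu'T, hu', hBu])
      exact hu (by rw [← hu', h3]; rfl)
    have hnum : normalNumerator B b T = (gramOn B T).det • fun t : T => w t := by
      rw [normalNumerator, ← hB, Matrix.mulVec_mulVec, Matrix.mulVec_mulVec, Matrix.mul_assoc]
      change ((gramOn B T).adjugate * gramOn B T).mulVec _ = _
      rw [Matrix.adjugate_mul, Matrix.smul_mulVec, Matrix.one_mulVec]
    refine ⟨T, hdet, fun t => ?_, fun i => ?_⟩
    · rw [hnum, Pi.smul_apply, smul_eq_mul, ← mul_assoc]
      exact mul_nonneg (mul_self_nonneg _) (hw _)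
    · rw [hnum, Matrix.mulVec_smul, hB, Pi.smul_apply, smul_eq_mul]
  · rintro ⟨T, hdet, hpos, heq⟩
    let w : n → ℝ := fun i =>
      if h : i ∈ T then normalNumerator B b T ⟨i, h⟩ / (gramOn B T).det else 0
    have hwT : ∀ i, i ∉ T → w i = 0 := fun i hi => dif_neg hi
    have hw : (fun t : T => w t) = (gramOn B T).det⁻¹ • normalNumerator B b T := by
      ext t
      simp [w, div_eq_inv_mul]
    refine ⟨w, fun i => ?_, ?_⟩
    · by_cases hi : i ∈ T
      · simp only [w, hi, dif_pos, Pi.zero_apply]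
        rw [div_eq_mul_inv, ← mul_inv_cancel_right₀ hdet (normalNumerator B b T ⟨i, hi⟩), mul_assoc]
        have h2 := mul_nonneg (hpos ⟨i, hi⟩) (mul_self_nonneg (gramOn B T).det⁻¹)
        calc 0 ≤ _ := h2
          _ = _ := by ring
      · rw [hwT i hi]
        rfl
    · rw [mulVec_eq_columnsIn hwT, hw, Matrix.mulVec_smul]
      ext i
      rw [Pi.smul_apply, heq, smul_eq_mul, inv_mul_cancel_left₀ hdet]

/-- Solvability in nonnegative reals of a linear system with polynomial data. -/
theorem eventuallyDecided_exists_nonneg_solution {k : ℕ} (B : Matrix m n (MvPolynomial (Fin k) ℝ))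
    (b : m → MvPolynomial (Fin k) ℝ) :
    EventuallyDecided (iteratedFilter k) fun y => ∃ w : n → ℝ, 0 ≤ w ∧
      (B.map (MvPolynomial.eval y)).mulVec w = MvPolynomial.eval y ∘ b := by
  simp only [exists_nonneg_solution_iff]
  refine EventuallyDecided.exists_finite fun T => ?_
  refine EventuallyDecided.and ?_ (EventuallyDecided.and ?_ ?_)
  · refine (eventuallyDecided_eval_eq (gramOn B T).det 0).not.congr
      (Eventually.of_forall fun y => ?_)
    rw [det_gramOn_map, map_zero]
  · refine EventuallyDecided.forall_finite fun t => ?_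
    refine (eventuallyDecided_eval_nonneg ((gramOn B T).det * normalNumerator B b T t)).congr
      (Eventually.of_forall fun y => ?_)
    rw [det_gramOn_map, normalNumerator_map, map_mul]
  · refine EventuallyDecided.forall_finite fun i => ?_
    refine (eventuallyDecided_eval_eq ((columnsIn B T).mulVec (normalNumerator B b T) i)
      ((gramOn B T).det * b i)).congr (Eventually.of_forall fun y => ?_)
    rw [det_gramOn_map, map_mul, RingHom.map_mulVec]
    have h1 : normalNumerator (B.map (MvPolynomial.eval y)) (MvPolynomial.eval y ∘ b) T =
        MvPolynomial.eval y ∘ normalNumerator B b T := funext fun t => normalNumerator_map _ _ _ _ t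
    rw [h1]
    rfl

end LinearSystem

section Tame

/-- `P` is eventually decided along the iterated filter, and so is every predicate obtained by
fixing the first few variables in the unit interval. -/
def Tame : {k : ℕ} → ((Fin k → ℝ) → Prop) → Prop
  | 0, _ => True
  | k + 1, P => EventuallyDecided (iteratedFilter (k + 1)) P ∧
      ∀ x ∈ Set.Ioo (0 : ℝ) 1, Tame fun y : Fin k → ℝ => P (Fin.cons x y)

theorem Tame.congr {k : ℕ} {P Q : (Fin k → ℝ) → Prop} (hP : Tame P)
    (h : ∀ y, (∀ i, y i ∈ Set.Ioo (0 : ℝ) 1) → (P y ↔ Q y)) : Tame Q := by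
  induction k with
  | zero => trivial
  | succ k ih =>
    refine ⟨hP.1.congr ?_, fun x hx => ih (hP.2 x hx) fun y hy => h _ (Fin.cons hx hy)⟩
    filter_upwards [eventually_mem_Ioo (k + 1)] with y hy using h y hy

theorem HasIterLim.exists_of_tame {k : ℕ} {f : (Fin k → ℝ) → EReal}
    (h : ∀ q : ℝ, Tame fun y => (q : EReal) ≤ f y) :
    ∃ L, HasIterLim f L ∧ Tendsto f (iteratedFilter k) (𝓝 L) := by
  induction k with
  | zero => exact ⟨f Fin.elim0, rfl, tendsto_pure_nhds f Fin.elim0⟩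
  | succ k ih =>
    obtain ⟨L, hL⟩ := exists_tendsto_of_eventuallyDecided fun q => (h q).1
    have hx : ∀ x : ℝ, ∃ L', x ∈ Set.Ioo (0 : ℝ) 1 →
        HasIterLim (fun y => f (Fin.cons x y)) L' ∧
          Tendsto (fun y => f (Fin.cons x y)) (iteratedFilter k) (𝓝 L') := by
      intro x
      by_cases hx : x ∈ Set.Ioo (0 : ℝ) 1
      · obtain ⟨L', hL'⟩ := ih fun q => (h q).2 x hx
        exact ⟨L', fun _ => hL'⟩
      · exact ⟨0, fun h => absurd h hx⟩
    choose g hg using hx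
    refine ⟨L, ⟨g, ?_, ?_⟩, hL⟩
    · filter_upwards [Ioo_mem_nhdsGT (zero_lt_one (α := ℝ))] with x hx using (hg x hx).1
    · refine (closed_nhds_basis L).tendsto_right_iff.2 fun U hU => ?_
      have h2 := hL.eventually_mem hU.1
      rw [eventually_iteratedFilter_succ] at h2
      filter_upwards [Ioo_mem_nhdsGT (zero_lt_one (α := ℝ)), h2] with x hx hxU
      exact hU.2.mem_of_tendsto (hg x hx).2 hxU

theorem eval_aeval_cons {k : ℕ} (x : ℝ) (y : Fin k → ℝ) (p : MvPolynomial (Fin (k + 1)) ℝ) :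
    MvPolynomial.eval y (MvPolynomial.aeval
      (Fin.cons (MvPolynomial.C x) MvPolynomial.X : Fin (k + 1) → MvPolynomial (Fin k) ℝ) p) =
      MvPolynomial.eval (Fin.cons x y : Fin (k + 1) → ℝ) p := by
  induction p using MvPolynomial.induction_on with
  | C a => simp
  | add p q hp hq => simp only [map_add, hp, hq]
  | mul_X p i hp =>
    simp only [map_mul, hp, MvPolynomial.aeval_X, MvPolynomial.eval_X]
    congr 1
    refine Fin.cases ?_ (fun i => ?_) i <;> simp

theorem tame_exists_nonneg_solution {m n : Type*} [Fintype m] [Fintype n] [DecidableEq n] {k : ℕ}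
    (B : Matrix m n (MvPolynomial (Fin k) ℝ)) (b : m → MvPolynomial (Fin k) ℝ) :
    Tame fun y => ∃ w : n → ℝ, 0 ≤ w ∧
      (B.map (MvPolynomial.eval y)).mulVec w = MvPolynomial.eval y ∘ b := by
  induction k with
  | zero => trivial
  | succ k ih =>
    refine ⟨eventuallyDecided_exists_nonneg_solution B b, fun x hx => ?_⟩
    let φ : MvPolynomial (Fin (k + 1)) ℝ → MvPolynomial (Fin k) ℝ := MvPolynomial.aeval
      (Fin.cons (MvPolynomial.C x) MvPolynomial.X : Fin (k + 1) → MvPolynomial (Fin k) ℝ)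
    refine (ih (B.map φ) (φ ∘ b)).congr fun y _ => ?_
    have h1 : (B.map φ).map (MvPolynomial.eval y) =
        B.map (MvPolynomial.eval (Fin.cons x y : Fin (k + 1) → ℝ)) := by
      ext i j
      exact eval_aeval_cons x y _
    have h2 : MvPolynomial.eval y ∘ φ ∘ b =
        MvPolynomial.eval (Fin.cons x y : Fin (k + 1) → ℝ) ∘ b := by
      ext i
      exact eval_aeval_cons x y _
    rw [h1, h2]

theorem tame_matrixVal_nonneg {I J : Type*} [Fintype I] [Fintype J] [Nonempty I] [Nonempty J]
    {k : ℕ} (N : Matrix I J (MvPolynomial (Fin k) ℝ)) :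
    Tame fun y => 0 ≤ matrixVal (N.map (MvPolynomial.eval y)) := by
  classical
  let B : Matrix (Unit ⊕ J) (I ⊕ J) (MvPolynomial (Fin k) ℝ) :=
    Matrix.fromBlocks (Matrix.of fun _ _ => 1) 0 N.transpose (-1)
  let b : Unit ⊕ J → MvPolynomial (Fin k) ℝ := Sum.elim (fun _ => 1) 0
  refine (tame_exists_nonneg_solution B b).congr fun y _ => ?_
  rw [le_matrixVal_iff]
  have hB : ∀ w : I ⊕ J → ℝ, (B.map (MvPolynomial.eval y)).mulVec w = MvPolynomial.eval y ∘ b ↔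
      ∑ i, w (Sum.inl i) = 1 ∧
        ∀ j, ∑ i, w (Sum.inl i) * MvPolynomial.eval y (N i j) = w (Sum.inr j) := by
    intro w
    rw [funext_iff, Sum.forall]
    refine and_congr ?_ (forall_congr' fun j => ?_)
    · simp [B, b, Matrix.mulVec, dotProduct]
    · have h1 : ∑ x, w (Sum.inr x) *
          MvPolynomial.eval y ((-1 : Matrix J J (MvPolynomial (Fin k) ℝ)) j x) = -w (Sum.inr j) := by
        rw [Finset.sum_eq_single j]
        · simp
        · intro x _ hx
          simp [Matrix.one_apply_ne hx.symm]
        · simp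
      simp only [Matrix.mulVec, dotProduct, Fintype.sum_sum_type, B, b, Matrix.map_apply,
        Matrix.fromBlocks_apply₂₁, Matrix.fromBlocks_apply₂₂, Matrix.transpose_apply,
        Function.comp_apply, Sum.elim_inr, Pi.zero_apply, map_zero,
        mul_comm (MvPolynomial.eval y _)]
      rw [h1, ← sub_eq_add_neg, sub_eq_zero]
  simp only [hB]
  constructor
  · rintro ⟨w, hw, h1, h2⟩
    exact ⟨fun i => w (Sum.inl i), ⟨fun i => hw _, h1⟩, fun j => by
      simp only [Matrix.map_apply, h2]
      exact hw _⟩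
  · rintro ⟨x, hx, h⟩
    exact ⟨Sum.elim x fun j => ∑ i, x i * MvPolynomial.eval y (N i j),
      Sum.rec hx.1 h, hx.2, fun j => rfl⟩

theorem tame_le_matrixVal {I J : Type*} [Fintype I] [Fintype J] [Nonempty I] [Nonempty J]
    {k : ℕ} (N : Matrix I J (MvPolynomial (Fin k) ℝ)) (p : MvPolynomial (Fin k) ℝ) :
    Tame fun y => MvPolynomial.eval y p ≤ matrixVal (N.map (MvPolynomial.eval y)) := by
  refine (tame_matrixVal_nonneg (Matrix.of fun i j => N i j - p)).congr fun y _ => ?_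
  simp only [le_matrixVal_iff]
  refine exists_congr fun x => and_congr_right fun hx => forall_congr' fun j => ?_
  simp only [Matrix.map_apply, Matrix.of_apply, map_sub, mul_sub, Finset.sum_sub_distrib,
    ← Finset.sum_mul, hx.2, one_mul, sub_nonneg]

end Tame

namespace CSG

variable {S A B : Type*} [Fintype S] [DecidableEq S] [Fintype A] [Fintype B] (G : CSG S A B)
  (r : S → A → B → ℝ) {d : ℕ} (χ : S → Fin (d + 1))

/-- The matrix `Id - diag (1 - Λ) P` as a polynomial in the discount factors. -/
noncomputable def polyDiscountedMatrix (P : Matrix S S ℝ) : Matrix S S (MvPolynomial (Fin (d + 1)) ℝ) :=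
  1 - Matrix.of fun s s' => (1 - MvPolynomial.X (χ s)) * MvPolynomial.C (P s s')

/-- The auxiliary matrix game as a polynomial in the discount factors. -/
noncomputable def polyAuxGame (s : S) (z : ℝ) : Matrix (S → A) (S → B) (MvPolynomial (Fin (d + 1)) ℝ) :=
  Matrix.of fun σ τ =>
    ((polyDiscountedMatrix χ (G.pureTrans σ τ)).updateCol s fun s' =>
      MvPolynomial.X (χ s') * MvPolynomial.C (r s' (σ s') (τ s'))).det -
    MvPolynomial.C z * (polyDiscountedMatrix χ (G.pureTrans σ τ)).det

omit [Fintype S] in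
theorem polyDiscountedMatrix_map (P : Matrix S S ℝ) (y : Fin (d + 1) → ℝ) :
    (polyDiscountedMatrix χ P).map (MvPolynomial.eval y) =
      discountedMatrix (fun s => y (χ s)) P := by
  ext s s'
  by_cases h : s = s' <;> simp [polyDiscountedMatrix, discountedMatrix, h]

theorem polyAuxGame_map (s : S) (z : ℝ) (y : Fin (d + 1) → ℝ) :
    (G.polyAuxGame r χ s z).map (MvPolynomial.eval y) =
      G.auxGame r (fun s' => y (χ s')) s z := by
  ext σ τ
  rw [auxGame_apply, Matrix.map_apply, polyAuxGame, Matrix.of_apply, map_sub, map_mul,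
    RingHom.map_det, RingHom.map_det, RingHom.mapMatrix_apply, RingHom.mapMatrix_apply,
    Matrix.map_updateCol, polyDiscountedMatrix_map, MvPolynomial.eval_C]
  congr 4
  ext s'
  simp

variable [Nonempty A] [Nonempty B]

theorem tame_le_discVal (s : S) (q : ℝ) :
    Tame fun lam : Fin (d + 1) → ℝ =>
      (q : EReal) ≤ ((G.discVal r (fun s' => lam (χ s')) s : ℝ) : EReal) := by
  refine (tame_matrixVal_nonneg (G.polyAuxGame r χ s q)).congr fun y hy => ?_
  rw [polyAuxGame_map, EReal.coe_le_coe_iff,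
    G.le_discVal_iff (fun s => (hy _).1) fun s => (hy _).2.le]

theorem tame_le_normalizedVal (s : S) (z q : ℝ) :
    Tame fun lam : Fin (d + 1) → ℝ => (q : EReal) ≤ G.normalizedVal r χ s z lam := by
  refine (tame_le_matrixVal (G.polyAuxGame r χ s z)
    (MvPolynomial.C q * MvPolynomial.X (Fin.last d) ^ Fintype.card S)).congr fun y hy => ?_
  rw [polyAuxGame_map, normalizedVal, EReal.coe_le_coe_iff,
    le_div_iff₀ (pow_pos (hy (Fin.last d)).1 _)]
  simp

end CSG

theorem eventually_last_le (d : ℕ) :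
    ∀ᶠ y in iteratedFilter (d + 1), ∀ i, y (Fin.last d) ≤ y i := by
  induction d with
  | zero => exact Eventually.of_forall fun y i => by rw [Fin.fin_one_eq_zero i]; rfl
  | succ d ih =>
    have hsmall : ∀ (k : ℕ) (x : ℝ), 0 < x →
        ∀ᶠ y in iteratedFilter k, ∀ i, y i < x := by
      intro k x hx
      induction k with
      | zero => exact Eventually.of_forall fun y i => i.elim0
      | succ k ihk =>
        rw [eventually_iteratedFilter_succ]
        filter_upwards [Ioo_mem_nhdsGT hx] with t ht
        filter_upwards [ihk] with y hy
        exact Fin.cons ht.2 hy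
    rw [eventually_iteratedFilter_succ]
    filter_upwards [self_mem_nhdsWithin] with x hx
    filter_upwards [ih, hsmall (d + 1) x hx] with y hy hyx
    rw [← Fin.succ_last]
    refine Fin.cases ?_ fun i => ?_
    · simpa using (hyx _).le
    · simpa using hy i

namespace CSG

variable {S A B : Type*} [Fintype S] [DecidableEq S] [Fintype A] [Fintype B] (G : CSG S A B)
  (r : S → A → B → ℝ) {d : ℕ} (χ : S → Fin (d + 1)) [Nonempty A] [Nonempty B]

omit [DecidableEq S] in
theorem eventually_pow_le_prod :
    ∀ᶠ lam in iteratedFilter (d + 1), lam (Fin.last d) ^ Fintype.card S ≤ ∏ s, lam (χ s) := by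
  filter_upwards [eventually_last_le d, eventually_mem_Ioo (d + 1)] with y h1 h2
  calc y (Fin.last d) ^ Fintype.card S = ∏ _s : S, y (Fin.last d) := by
        rw [Finset.prod_const, Finset.card_univ]
    _ ≤ _ := Finset.prod_le_prod (fun s _ => (h2 _).1.le) fun s _ => h1 _

theorem exists_hasIterLim_discVal (s : S) : ∃ v : ℝ,
    HasIterLim (fun lam : Fin (d + 1) → ℝ => ((G.discVal r (fun s' => lam (χ s')) s : ℝ) : EReal))
      v ∧
    Tendsto (fun lam : Fin (d + 1) → ℝ => G.discVal r (fun s' => lam (χ s')) s)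
      (iteratedFilter (d + 1)) (𝓝 v) := by
  obtain ⟨L, hL, hT⟩ := HasIterLim.exists_of_tame (G.tame_le_discVal r χ s)
  obtain ⟨R, -, hR⟩ := exists_reward_bound r
  have hmem : ∀ᶠ lam in iteratedFilter (d + 1),
      ((G.discVal r (fun s' => lam (χ s')) s : ℝ) : EReal) ∈
        Set.Icc ((-R : ℝ) : EReal) ((R : ℝ) : EReal) := by
    filter_upwards [eventually_mem_Ioo (d + 1)] with y hy
    have h2 := abs_le.1 (G.abs_discVal_le hR (fun s => (hy (χ s)).1) (fun s => (hy (χ s)).2.le) s)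
    exact ⟨EReal.coe_le_coe_iff.2 h2.1, EReal.coe_le_coe_iff.2 h2.2⟩
  have hI := isClosed_Icc.mem_of_tendsto hT hmem
  lift L to ℝ using ⟨(hI.2.trans_lt (EReal.coe_lt_top R)).ne,
    ((EReal.bot_lt_coe _).trans_le hI.1).ne'⟩
  exact ⟨L, hL, EReal.tendsto_coe.1 hT⟩

theorem exists_hasIterLim_normalizedVal (s : S) (z : ℝ) : ∃ L,
    HasIterLim (G.normalizedVal r χ s z) L ∧
      Tendsto (G.normalizedVal r χ s z) (iteratedFilter (d + 1)) (𝓝 L) :=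
  HasIterLim.exists_of_tame (G.tame_le_normalizedVal r χ s z)

theorem pos_of_tendsto_normalizedVal {s : S} {v z : ℝ} {L : EReal}
    (hv : Tendsto (fun lam : Fin (d + 1) → ℝ => G.discVal r (fun s' => lam (χ s')) s)
      (iteratedFilter (d + 1)) (𝓝 v))
    (hL : Tendsto (G.normalizedVal r χ s z) (iteratedFilter (d + 1)) (𝓝 L)) (hz : z < v) :
    0 < L := by
  have hε : 0 < (v - z) / 2 := by linarith
  refine (EReal.coe_pos.2 hε).trans_le (ge_of_tendsto hL ?_)
  filter_upwards [hv.eventually_const_lt (show z + (v - z) / 2 < v by linarith),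
    eventually_mem_Ioo (d + 1), eventually_pow_le_prod χ] with y h1 h2 h3
  rw [normalizedVal, EReal.coe_le_coe_iff, le_div_iff₀ (pow_pos (h2 (Fin.last d)).1 _)]
  have h4 := G.prod_mul_le_matrixVal_auxGame (r := r) (fun s => (h2 (χ s)).1)
    (fun s => (h2 (χ s)).2.le) (s := s) (z := z) (by linarith)
  refine le_trans ?_ h4
  rw [mul_comm]
  exact mul_le_mul h3 (by linarith) hε.le
    (Finset.prod_nonneg fun s _ => (h2 (χ s)).1.le)

theorem neg_of_tendsto_normalizedVal {s : S} {v z : ℝ} {L : EReal}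
    (hv : Tendsto (fun lam : Fin (d + 1) → ℝ => G.discVal r (fun s' => lam (χ s')) s)
      (iteratedFilter (d + 1)) (𝓝 v))
    (hL : Tendsto (G.normalizedVal r χ s z) (iteratedFilter (d + 1)) (𝓝 L)) (hz : v < z) :
    L < 0 := by
  have hε : 0 < (z - v) / 2 := by linarith
  refine (le_of_tendsto hL (b := ((-((z - v) / 2) : ℝ) : EReal)) ?_).trans_lt
    (EReal.coe_neg'.2 (neg_neg_of_pos hε))
  filter_upwards [hv.eventually_lt_const (show v < z - (z - v) / 2 by linarith),
    eventually_mem_Ioo (d + 1), eventually_pow_le_prod χ] with y h1 h2 h3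
  rw [normalizedVal, EReal.coe_le_coe_iff, div_le_iff₀ (pow_pos (h2 (Fin.last d)).1 _)]
  have h4 := G.matrixVal_auxGame_le_prod_mul (r := r) (fun s => (h2 (χ s)).1)
    (fun s => (h2 (χ s)).2.le) (s := s) (z := z) (by linarith)
  refine h4.trans ?_
  have h5 : y (Fin.last d) ^ Fintype.card S * ((z - v) / 2) ≤
      (∏ s, y (χ s)) * (z - G.discVal r (fun s' => y (χ s')) s) :=
    mul_le_mul h3 (by linarith) hε.le (Finset.prod_nonneg fun s _ => (h2 (χ s)).1.le)
  linarith

end CSG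

theorem mainTheorem4 {S A B : Type*} [Fintype S] [DecidableEq S] [Fintype A] [Nonempty A]
    [Fintype B] [Nonempty B] (G : CSG S A B) (r : S → A → B → ℝ) {d : ℕ}
    (χ : S → Fin (d + 1)) (s : S) :
    -- the limit function exists in the extended reals
    (∀ z : ℝ, HasIterLim (G.normalizedVal r χ s z) (G.limitFun r χ s z)) ∧
    -- it takes a nonpositive and a nonnegative value
    (∃ z₁ z₂ : ℝ, G.limitFun r χ s z₂ ≤ 0 ∧ 0 ≤ G.limitFun r χ s z₁) ∧
    -- the limit value exists as a real number
    HasIterLim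
      (fun lam : Fin (d + 1) → ℝ => ((G.discVal r (fun s' => lam (χ s')) s : ℝ) : EReal))
      ((G.limitVal r χ s : ℝ) : EReal) ∧
    -- the limit value is the unique point where the limit function changes sign
    (∀ z' : ℝ,
      ((∀ z : ℝ, z' < z → G.limitFun r χ s z < 0) ∧ (∀ z : ℝ, z < z' → 0 < G.limitFun r χ s z)) ↔
        z' = G.limitVal r χ s) := by
  obtain ⟨v, hv, hvT⟩ := G.exists_hasIterLim_discVal r χ s
  choose F hF hFT using G.exists_hasIterLim_normalizedVal r χ s
  have hlimF : ∀ z, G.limitFun r χ s z = F z := fun z => (hF z).iterLim_eq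
  have hlimV : G.limitVal r χ s = v := by
    rw [CSG.limitVal, hv.iterLim_eq, EReal.toReal_coe]
  have hpos : ∀ z, z < v → 0 < F z := fun z hz =>
    G.pos_of_tendsto_normalizedVal r χ hvT (hFT z) hz
  have hneg : ∀ z, v < z → F z < 0 := fun z hz =>
    G.neg_of_tendsto_normalizedVal r χ hvT (hFT z) hz
  simp only [hlimF, hlimV]
  refine ⟨hF, ⟨v - 1, v + 1, (hneg _ (by linarith)).le, (hpos _ (by linarith)).le⟩, hv,
    fun z' => ⟨fun h => ?_, fun h => by subst h; exact ⟨hneg, hpos⟩⟩⟩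
  rcases lt_trichotomy z' v with hlt | heq | hgt
  · obtain ⟨z, h1, h2⟩ := exists_between hlt
    exact absurd (h.1 z h1) (hpos z h2).not_gt
  · exact heq
  · obtain ⟨z, h1, h2⟩ := exists_between hgt
    exact absurd (h.2 z h2) (hneg z h1).not_gt
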